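/- Let $u>0$. Three qubit matrices are the complex $8\times 8$ matrices acting on $\mathbb C^2\otimes\mathbb C^2\otimes\mathbb C^2$ (parties $A,B,C$), written in the basis $|000\rangle,|001\rangle,\dots,|111\rangle$ in lexicographic order. A state is a positive semi-definite matrix of trace one; a pure product state is $|\xi\rangle\langle\xi|$ with $|\xi\rangle=|x\rangle\otimes|y\rangle\otimes|z\rangle$ a unit vector; a separable state is a convex combination of pure product states, and its length is the least number of pure product states in such a combination. Put $\langle V,\varrho\rangle=\operatorname{Tr}(\varrho V^{\mathrm t})$. An entanglement witness is a self-adjoint $V$ with $\langle V,\varrho\rangle\ge 0$ for all separable states $\varrho$ and $\langle V,\varrho\rangle<0$ for some state $\varrho$. The dual face of $V$ is the set of all separable states $\varrho$ with $\langle V,\varrho\rangle=0$. For $a,b,c\in\mathbb R^4$ let $X(a,b,c)$ be the matrix with diagonal $(a_1,a_2,a_3,a_4,b_4,b_3,b_2,b_1)$, anti-diagonal $(c_1,c_2,c_3,c_4,c_4,c_3,c_2,c_1)$ and all other entries zero. Let $$W=X\big((0,0,0,\sqrt 8\,u^{-1}),(0,0,0,\sqrt 8\,u),(1,1,-1,1)\big)$$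 and, for $P\in\{A,B,C\}$, let $W_P=\sigma_P W^{\Gamma_P}\sigma_P$, where $\Gamma_P$ is the partial transpose with respect to party $P$ and $\sigma_P$ is the bit flip $\begin{pmatrix}0&1\\1&0\end{pmatrix}$ on party $P$ (tensored with the identity on the others). With $\omega=e^{\mathrm i\pi/4}$ let $\Lambda_1=(\omega^3,\omega,\omega^7)$, $\Lambda_2=(\omega^3,-\omega,-\omega^7)$, $\Lambda_3=(-\omega^3,\omega,-\omega^7)$, $\Lambda_4=(-\omega^3,-\omega,\omega^7)$, $\Lambda_j=\overline{\Lambda_{j-4}}$ for $j=5,\dots,8$, and for $p,q,r>0$ and $\Lambda_j=(\alpha,\beta,\gamma)$ let $$|\eta_j(p,q,r)\rangle=(pqr)^{-1/2}\,(p,\alpha)^{\mathrm t}\otimes(q,\beta)^{\mathrm t}\otimes(r,\gamma)^{\mathrm t}.$$ **Theorem.** Each of $W+W_A+W_B$, $W+W_B+W_C$, $W+W_C+W_A$ and $W_A+W_B+W_C$ is an entanglement witness. Let $F$ be the dual face of one of them. Then: (i) $F$ is affinely isomorphic to the $9$-dimensional simplex, and it has exactly ten extreme points, namely the (normalized) pure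 product states given by the product vectors - $|010\rangle,\ |101\rangle,\ |\eta_j(1,1,u^{-1})\rangle$ $(j=1,\dots,8)$ for $W+W_A+W_B$, - $|000\rangle,\ |111\rangle,\ |\eta_j(u,1,1)\rangle$ $(j=1,\dots,8)$ for $W+W_B+W_C$, - $|001\rangle,\ |110\rangle,\ |\eta_j(1,u^{-1},1)\rangle$ $(j=1,\dots,8)$ for $W+W_C+W_A$, - $|011\rangle,\ |100\rangle,\ |\eta_j(u,u^{-1},u^{-1})\rangle$ $(j=1,\dots,8)$ for $W_A+W_B+W_C$. (ii) Every point of $F$ is a separable state that has a unique decomposition as a convex combination of distinct pure product states with positive weights (up to the order of the terms). (iii) Every (relative) interior point of $F$ is a boundary separable state with full ranks, that is, it lies on the boundary of the convex set of all separable states (relative to its affine hull) and its partial transposes with respect to all subsets of the parties have full rank eight; and it has length exactly ten. -/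

import Mathlib

open scoped Kronecker ComplexOrder

noncomputable section

namespace ThreeQubit

/-- Labels `(i, j, k)` of the computational basis of `ℂ² ⊗ ℂ² ⊗ ℂ²`. -/
abbrev Idx : Type := Fin 2 × Fin 2 × Fin 2

/-- Three qubit matrices `M₂ ⊗ M₂ ⊗ M₂`. -/
abbrev Mat : Type := Matrix Idx Idx ℂ

/-- The product vector `|x⟩ ⊗ |y⟩ ⊗ |z⟩`. -/
def prodVec (x y z : Fin 2 → ℂ) : Idx → ℂ := fun i => x i.1 * y i.2.1 * z i.2.2

/-- The (normalized) pure state on the line spanned by a nonzero vector `v`,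
namely `|v⟩⟨v| / ⟨v|v⟩`. -/
def pureState (v : Idx → ℂ) : Mat := (star v ⬝ᵥ v)⁻¹ • Matrix.vecMulVec v (star v)

/-- Three qubit states: density matrices. -/
def states : Set Mat := {ρ | ρ.PosSemidef ∧ ρ.trace = 1}

/-- Pure product states `|ξ⟩⟨ξ|`, with `|ξ⟩` a product vector of norm one. -/
def pureProductStates : Set Mat :=
  {ρ | ∃ x y z : Fin 2 → ℂ, star (prodVec x y z) ⬝ᵥ prodVec x y z = 1 ∧
    ρ = Matrix.vecMulVec (prodVec x y z) (star (prodVec x y z))}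

/-- Separable states: convex combinations of pure product states. -/
def separableStates : Set Mat := convexHull ℝ pureProductStates

/-- The bilinear pairing `⟨V, ρ⟩ = Tr (ρ Vᵗ)`. -/
def pairing (V ρ : Mat) : ℂ := (ρ * V.transpose).trace

/-- Entanglement witnesses: self-adjoint matrices, nonnegative on all separable states and
negative on some state. -/
def IsEntanglementWitness (V : Mat) : Prop :=
  V.IsHermitian ∧ (∀ ρ ∈ separableStates, 0 ≤ (pairing V ρ).re) ∧
    ∃ ρ ∈ states, (pairing V ρ).re < 0

/-- The dual face of `V`: all separable states `ρ` with `⟨V, ρ⟩ = 0`. -/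
def dualFace (V : Mat) : Set Mat := {ρ ∈ separableStates | pairing V ρ = 0}

/-- The partial transpose with respect to the parties in `S`, where `0`, `1`, `2` stand for
the parties `A`, `B`, `C`. -/
def partialTranspose (S : Finset (Fin 3)) (M : Mat) : Mat := Matrix.of fun i j =>
  M (if 0 ∈ S then j.1 else i.1, if 1 ∈ S then j.2.1 else i.2.1, if 2 ∈ S then j.2.2 else i.2.2)
    (if 0 ∈ S then i.1 else j.1, if 1 ∈ S then i.2.1 else j.2.1, if 2 ∈ S then i.2.2 else j.2.2)

/-- The bit bitFlip on one qubit. -/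
def bitFlip : Matrix (Fin 2) (Fin 2) ℂ := !![0, 1; 1, 0]

def flipA : Mat := bitFlip ⊗ₖ ((1 : Matrix (Fin 2) (Fin 2) ℂ) ⊗ₖ (1 : Matrix (Fin 2) (Fin 2) ℂ))

def flipB : Mat := (1 : Matrix (Fin 2) (Fin 2) ℂ) ⊗ₖ (bitFlip ⊗ₖ (1 : Matrix (Fin 2) (Fin 2) ℂ))

def flipC : Mat := (1 : Matrix (Fin 2) (Fin 2) ℂ) ⊗ₖ ((1 : Matrix (Fin 2) (Fin 2) ℂ) ⊗ₖ bitFlip)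

/-- The position of a label in the lexicographic order `000, 001, …, 111`. -/
def lexPos (i : Idx) : Fin 8 := ⟨4 * i.1 + 2 * i.2.1 + i.2.2, by omega⟩

/-- Kye's X-shaped witness with parameter `u`, in the lexicographically ordered basis. -/
def W (u : ℝ) : Mat := Matrix.submatrix
  (!![0, 0,  0, 0, 0, 0, 0, 1;
      0, 0,  0, 0, 0, 0, 1, 0;
      0, 0,  0, 0, 0, -1, 0, 0;
      0, 0,  0, ((√8 * u⁻¹ : ℝ) : ℂ), 1, 0, 0, 0;
      0, 0,  0, 1, ((√8 * u : ℝ) : ℂ), 0, 0, 0;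
      0, 0, -1, 0, 0, 0, 0, 0;
      0, 1,  0, 0, 0, 0, 0, 0;
      1, 0,  0, 0, 0, 0, 0, 0] : Matrix (Fin 8) (Fin 8) ℂ) lexPos lexPos

def WA (u : ℝ) : Mat := flipA * partialTranspose {0} (W u) * flipA

def WB (u : ℝ) : Mat := flipB * partialTranspose {1} (W u) * flipB

def WC (u : ℝ) : Mat := flipC * partialTranspose {2} (W u) * flipC

/-- The primitive eighth root of unity `e^{iπ/4}`. -/
def ω : ℂ := Complex.exp (Complex.I * (Real.pi / 4))

/-- The eight phase triples; the last four are the complex conjugates of the first four. -/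
def phase : Fin 8 → Fin 3 → ℂ :=
  ![![ω ^ 3, ω, ω ^ 7],
    ![ω ^ 3, -ω, -ω ^ 7],
    ![-ω ^ 3, ω, -ω ^ 7],
    ![-ω ^ 3, -ω, ω ^ 7],
    star ![ω ^ 3, ω, ω ^ 7],
    star ![ω ^ 3, -ω, -ω ^ 7],
    star ![-ω ^ 3, ω, -ω ^ 7],
    star ![-ω ^ 3, -ω, ω ^ 7]]

/-- The product vectors `(pqr)^{-1/2} (p, α)ᵗ ⊗ (q, β)ᵗ ⊗ (r, γ)ᵗ`, with `(α, β, γ)` the `j`-th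
phase triple. -/
def eta (p q r : ℝ) (j : Fin 8) : Idx → ℂ :=
  (√(p * q * r))⁻¹ • prodVec ![(p : ℂ), phase j 0] ![(q : ℂ), phase j 1] ![(r : ℂ), phase j 2]

/-- Two sets in real vector spaces are affinely isomorphic: an affine map restricts to a
bijection between them. -/
def AffinelyIsomorphic {E E' : Type*} [AddCommGroup E] [Module ℝ E] [AddCommGroup E']
    [Module ℝ E'] (S : Set E) (T : Set E') : Prop :=
  ∃ f : E →ᵃ[ℝ] E', Set.BijOn f S T

/-- `w` is a decomposition of `ρ` into pure product states: the convex combination of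
finitely many distinct pure product states `P`, with weights `w P`, that is equal to `ρ`. -/
def IsDecomposition (ρ : Mat) (w : Mat →₀ ℝ) : Prop :=
  (w.support : Set Mat) ⊆ pureProductStates ∧ (∀ P, 0 ≤ w P) ∧
    (w.sum fun _ a => a) = 1 ∧ (w.sum fun P a => a • P) = ρ

/-- The length of a separable state: the smallest number of pure product states of which it
is a convex combination. -/
def sepLength (ρ : Mat) : ℕ :=
  sInf {n | ∃ (P : Fin n → Mat) (c : Fin n → ℝ), (∀ i, P i ∈ pureProductStates) ∧
    (∀ i, 0 ≤ c i) ∧ ∑ i, c i = 1 ∧ ∑ i, c i • P i = ρ}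

/-- Boundary separable states with full ranks: on the boundary of the convex set of separable
states (relative to its affine hull), with all partial transposes of full rank. -/
def IsBoundarySeparableFullRanks (ρ : Mat) : Prop :=
  ρ ∈ separableStates ∧ ρ ∈ intrinsicFrontier ℝ separableStates ∧
    ∀ S : Finset (Fin 3), (partialTranspose S ρ).rank = 8

end ThreeQubit

end

open ThreeQubit

/-! All four witnesses have one shape, `xWitness p q r b`: anti-diagonal entries ±3 and diagonal
entries `√8 / weight`, except for zeros at one pair of opposite labels `b`, `opp b`. Since `weight`
is a product over the parties, an invertible local diagonal rescaling reduces the values on product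
vectors to the case `p = q = r = 1`.

For a product vector the product of the moduli of two opposite entries is the same number `m` for
all four opposite pairs. The three pairs with nonzero diagonal contribute at least `6√8 m` by AM-GM,
and the anti-diagonal part is at least `-6√8 m` by Cauchy-Schwarz, so the witness is nonnegative. A
zero requires equality in both estimates. If `m = 0`, only the basis vectors at `b` and `opp b`
survive, up to scalars. If `m ≠ 0`, all factors have entries of equal moduli and the relative phases
form one of eight triples. These ten zeros are the vertices (`prodVec_of_witnessForm_one_eq_zero`,
`mem_range_vertex_iff`).

A functional that is nonnegative on pure product states cuts out the convex hull of its zeros, so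
the dual face is the hull of ten states. They are linearly independent (`linearIndependent_vertex`),
hence the face is a simplex. Any decomposition of a point of the face uses only these vertices,
which gives uniqueness, and length ten when all weights are positive. Points of the face are
boundary points because the witness functional vanishes there without vanishing on all separable
states. Full ranks hold because the eight vectors `eta` still span after any partial conjugation
(`eq_zero_of_phasePattern`). -/

/-! ### Simplicial faces of convex hulls -/

section SimplicialFace

variable {E : Type*} [AddCommGroup E] [Module ℝ E]

/-- A linear functional that is nonnegative on `s` cuts out of the convex hull of `s` the convex
hull of its zeros in `s`. -/
theorem convexHull_sep_eq_zero {s t : Set E} {f : E →ₗ[ℝ] ℝ} (hf : ∀ x ∈ s, 0 ≤ f x)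
    (ht : ∀ x, x ∈ t ↔ x ∈ s ∧ f x = 0) :
    {x ∈ convexHull ℝ s | f x = 0} = convexHull ℝ t := by
  apply Set.Subset.antisymm
  · have hsub : convexHull ℝ s ⊆ {x | 0 ≤ f x ∧ (f x = 0 → x ∈ convexHull ℝ t)} := by
      refine convexHull_min (fun x hx => ⟨hf x hx, fun h0 =>
        subset_convexHull ℝ t ((ht x).2 ⟨hx, h0⟩)⟩) ?_
      intro x hx y hy a b ha hb hab
      have hfab : f (a • x + b • y) = a * f x + b * f y := by simp
      have hax := mul_nonneg ha hx.1
      have hby := mul_nonneg hb hy.1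
      refine ⟨by rw [hfab]; positivity, fun h0 => ?_⟩
      rw [hfab] at h0
      have h1 : a * f x = 0 := by linarith
      have h2 : b * f y = 0 := by linarith
      rcases mul_eq_zero.1 h1 with rfl | h1
      · have hb1 : b = 1 := by linarith
        subst hb1
        simpa using hy.2 (by simpa using h2)
      rcases mul_eq_zero.1 h2 with rfl | h2
      · have ha1 : a = 1 := by linarith
        subst ha1
        simpa using hx.2 (by simpa using h1)
      exact convex_convexHull ℝ t (hx.2 h1) (hy.2 h2) ha hb hab
    exact fun x hx => (hsub hx.1).2 hx.2
  · intro x hx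
    refine ⟨convexHull_mono (fun y hy => ((ht y).1 hy).1) hx, ?_⟩
    have : convexHull ℝ t ⊆ {x | f x = 0} :=
      convexHull_min (fun y hy => ((ht y).1 hy).2) (convex_hyperplane f.isLinear 0)
    exact this hx

/-- A functional that is nonnegative on `s` and not identically zero there is positive on the
intrinsic interior of `s`. -/
theorem pos_of_mem_intrinsicInterior [TopologicalSpace E] [IsTopologicalAddGroup E]
    [ContinuousSMul ℝ E] {s : Set E} {f : E →ₗ[ℝ] ℝ} (hf : ∀ x ∈ s, 0 ≤ f x) {y : E}
    (hy : y ∈ s) (hfy : 0 < f y) {x : E} (hx : x ∈ intrinsicInterior ℝ s) : 0 < f x := by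
  obtain ⟨x, hx, rfl⟩ := mem_intrinsicInterior.1 hx
  let γ : ℝ → affineSpan ℝ s := fun t => ⟨AffineMap.lineMap (x : E) y t,
    AffineMap.lineMap_mem t x.2 (subset_affineSpan ℝ s hy)⟩
  have hγ : Continuous γ := by
    refine Continuous.subtype_mk ?_ _
    exact AffineMap.lineMap_continuous
  have hγ0 : γ 0 = x := Subtype.ext (by simp [γ])
  have hev : ∀ᶠ t in nhds (0 : ℝ), γ t ∈ interior ((↑) ⁻¹' s : Set (affineSpan ℝ s)) :=
    hγ.continuousAt.eventually_mem (isOpen_interior.mem_nhds (by rwa [hγ0]))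
  obtain ⟨ε, hε, hball⟩ := Metric.eventually_nhds_iff.1 hev
  -- A negative parameter moves past `x`, away from `y`, while staying in `s`; were `f x ≤ 0`, the
  -- value there would be negative.
  have hmem := interior_subset (hball (y := -(ε / 2)) (by
    rw [dist_zero_right, Real.norm_eq_abs, abs_neg, abs_of_pos (by positivity)]; linarith))
  have h0 := hf _ hmem
  simp only [γ, AffineMap.lineMap_apply_module, map_add, map_smul, smul_eq_mul] at h0
  have : 0 < ε / 2 * f y := by positivity
  by_contra! hneg
  nlinarith

variable {n : ℕ} {v : Fin n → E}

/-- A linear left inverse of the combination map: it turns coordinates in the family `v` into linear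
functionals on all of `E`. -/
theorem exists_coordinates (hv : LinearIndependent ℝ v) :
    ∃ g : E →ₗ[ℝ] (Fin n → ℝ), ∀ c : Fin n → ℝ, g (∑ i, c i • v i) = c := by
  obtain ⟨g, hg⟩ := (Fintype.linearCombination ℝ v).exists_leftInverse_of_injective
    (LinearMap.ker_eq_bot.2 hv.fintypeLinearCombination_injective)
  exact ⟨g, fun c => by simpa [Fintype.linearCombination_apply] using LinearMap.congr_fun hg c⟩

theorem convexHull_range_eq_image_stdSimplex (v : Fin n → E) :
    convexHull ℝ (Set.range v) = Fintype.linearCombination ℝ v '' stdSimplex ℝ (Fin n) := by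
  rw [← convexHull_rangle_single_eq_stdSimplex, LinearMap.image_convexHull, ← Set.range_comp]
  congr 2
  ext i
  simp

theorem mem_convexHull_range {x : E} : x ∈ convexHull ℝ (Set.range v) ↔
    ∃ c : Fin n → ℝ, (∀ i, 0 ≤ c i) ∧ ∑ i, c i = 1 ∧ ∑ i, c i • v i = x := by
  rw [convexHull_range_eq_image_stdSimplex]
  constructor
  · rintro ⟨c, hc, rfl⟩
    exact ⟨c, hc.1, hc.2, (Fintype.linearCombination_apply _ _ _).symm⟩
  · rintro ⟨c, h0, h1, rfl⟩
    exact ⟨c, ⟨h0, h1⟩, Fintype.linearCombination_apply _ _ _⟩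

theorem affinelyIsomorphic_convexHull_range (hv : LinearIndependent ℝ v) :
    AffinelyIsomorphic (stdSimplex ℝ (Fin n)) (convexHull ℝ (Set.range v)) := by
  refine ⟨(Fintype.linearCombination ℝ v).toAffineMap, ?_⟩
  rw [convexHull_range_eq_image_stdSimplex]
  exact hv.fintypeLinearCombination_injective.injOn.bijOn_image

theorem extremePoints_convexHull_range (hv : LinearIndependent ℝ v) :
    (convexHull ℝ (Set.range v)).extremePoints ℝ = Set.range v := by
  refine Set.Subset.antisymm extremePoints_convexHull_subset ?_
  rintro _ ⟨i, rfl⟩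
  obtain ⟨g, hg⟩ := exists_coordinates hv
  refine ⟨subset_convexHull ℝ _ ⟨i, rfl⟩, ?_⟩
  intro x hx y hy hxy
  obtain ⟨c, hc0, hc1, rfl⟩ := mem_convexHull_range.1 hx
  obtain ⟨d, hd0, hd1, rfl⟩ := mem_convexHull_range.1 hy
  obtain ⟨a, b, ha, hb, -, hab⟩ := hxy
  have hvi : v i = ∑ k, (Pi.single i 1 : Fin n → ℝ) k • v k := by
    simp [Pi.single_apply, ite_smul]
  have key : a • c + b • d = Pi.single i 1 := by
    have h := congrArg g hab
    rwa [map_add, map_smul, map_smul, hg, hg, hvi, hg] at h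
  have hc : ∀ k, k ≠ i → c k = 0 := by
    intro k hk
    have h := congrFun key k
    simp only [Pi.add_apply, Pi.smul_apply, smul_eq_mul, Pi.single_eq_of_ne hk] at h
    have h1 := mul_nonneg ha.le (hc0 k)
    have h2 := mul_nonneg hb.le (hd0 k)
    have h3 : a * c k = 0 := by linarith
    exact (mul_eq_zero.1 h3).resolve_left ha.ne'
  have hci : c i = 1 := by
    rwa [Finset.sum_eq_single i (fun k _ hk => hc k hk) (by simp)] at hc1
  rw [Finset.sum_eq_single i (fun k _ hk => by simp [hc k hk]) (by simp), hci, one_smul]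

/-- Nonnegative combinations of elements of `s` on which `f` vanishes involve only zeros of `f`. -/
theorem eq_zero_of_sum_eq_zero {ι : Type*} {s : Set E} {f : E →ₗ[ℝ] ℝ} (hf : ∀ x ∈ s, 0 ≤ f x)
    {T : Finset ι} {c : ι → ℝ} {z : ι → E} (hc : ∀ i ∈ T, 0 ≤ c i) (hz : ∀ i ∈ T, z i ∈ s)
    (h0 : f (∑ i ∈ T, c i • z i) = 0) {i : ι} (hi : i ∈ T) (hci : c i ≠ 0) : f (z i) = 0 := by
  simp only [map_sum, map_smul, smul_eq_mul] at h0
  have := (Finset.sum_eq_zero_iff_of_nonneg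
    (fun i hi => mul_nonneg (hc i hi) (hf _ (hz i hi)))).1 h0 i hi
  exact (mul_eq_zero.1 this).resolve_left hci

theorem exists_finsupp_decomposition (hv : LinearIndependent ℝ v) {x : E}
    (hx : x ∈ convexHull ℝ (Set.range v)) :
    ∃ w : E →₀ ℝ, (w.support : Set E) ⊆ Set.range v ∧ (∀ y, 0 ≤ w y) ∧
      (w.sum fun _ a => a) = 1 ∧ (w.sum fun y a => a • y) = x := by
  obtain ⟨c, hc0, hc1, rfl⟩ := mem_convexHull_range.1 hx
  let e : Fin n ↪ E := ⟨v, hv.injective⟩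
  refine ⟨(Finsupp.equivFunOnFinite.symm c).embDomain e, ?_, ?_, ?_, ?_⟩
  · intro y hy
    rw [Finset.mem_coe, Finsupp.support_embDomain, Finset.mem_map] at hy
    obtain ⟨i, -, rfl⟩ := hy
    exact ⟨i, rfl⟩
  · intro y
    by_cases hy : y ∈ Set.range e
    · obtain ⟨i, rfl⟩ := hy
      rw [Finsupp.embDomain_apply_self]
      exact hc0 i
    · rw [Finsupp.embDomain_of_notMem_range _ _ _ hy]
  · rw [Finsupp.sum_embDomain, Finsupp.sum_fintype _ _ (fun _ => rfl)]
    exact hc1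
  · rw [Finsupp.sum_embDomain, Finsupp.sum_fintype _ _ (by simp)]
    rfl

theorem finsupp_decomposition_unique (hv : LinearIndependent ℝ v) {w w' : E →₀ ℝ}
    (hw : (w.support : Set E) ⊆ Set.range v) (hw' : (w'.support : Set E) ⊆ Set.range v)
    (h : (w.sum fun y a => a • y) = w'.sum fun y a => a • y) : w = w' := by
  have hr : LinearIndepOn ℝ id (Set.range v) := hv.linearIndepOn_id
  exact linearIndepOn_iffₛ.1 hr w hw w' hw' (by simpa [Finsupp.linearCombination_apply] using h)

/-- If `x` has positive coordinates in the linearly independent family `v`, then any combination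
of members of `v` that is equal to `x` has at least as many terms as `v`. -/
theorem card_le_of_sum_eq (hv : LinearIndependent ℝ v) {c : Fin n → ℝ} (hc : ∀ i, 0 < c i)
    {m : ℕ} {d : Fin m → ℝ} {z : Fin m → E} (hz : ∀ k, d k ≠ 0 → z k ∈ Set.range v)
    (h : ∑ k, d k • z k = ∑ i, c i • v i) : n ≤ m := by
  obtain ⟨g, hg⟩ := exists_coordinates hv
  have hgv : ∀ i, g (v i) = Pi.single i 1 := by
    intro i
    rw [← hg (Pi.single i 1)]
    simp [Pi.single_apply, ite_smul]
  have hex : ∀ i, ∃ k, z k = v i := by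
    intro i
    -- If `v i` were missing among the used terms, the `i`-th coordinate of the left side would be
    -- zero instead of `c i`.
    by_contra! hne
    have h1 := congrFun (congrArg g h) i
    rw [hg, map_sum, Finset.sum_apply] at h1
    have h2 : ∀ k ∈ Finset.univ, g (d k • z k) i = 0 := by
      intro k _
      by_cases hd : d k = 0
      · simp [hd]
      · obtain ⟨j, hj⟩ := hz k hd
        have : i ≠ j := by
          rintro rfl
          exact hne k hj.symm
        simp [← hj, hgv, this]
    rw [Finset.sum_eq_zero h2] at h1
    exact (hc i).ne h1
  choose φ hφ using hex
  have hinj : Function.Injective φ := fun i j hij =>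
    hv.injective (by rw [← hφ i, ← hφ j, hij])
  simpa using Fintype.card_le_of_injective φ hinj

/-- Relative interior points of a simplex are positive combinations of its vertices. -/
theorem exists_pos_of_mem_intrinsicInterior [TopologicalSpace E] [IsTopologicalAddGroup E]
    [ContinuousSMul ℝ E] (hv : LinearIndependent ℝ v) {x : E}
    (hx : x ∈ intrinsicInterior ℝ (convexHull ℝ (Set.range v))) :
    ∃ c : Fin n → ℝ, (∀ i, 0 < c i) ∧ ∑ i, c i = 1 ∧ ∑ i, c i • v i = x := by
  obtain ⟨c, -, hc1, rfl⟩ := mem_convexHull_range.1 (intrinsicInterior_subset hx)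
  obtain ⟨g, hg⟩ := exists_coordinates hv
  refine ⟨c, fun i => ?_, hc1, rfl⟩
  have hvi : v i = ∑ k, (Pi.single i 1 : Fin n → ℝ) k • v k := by
    simp [Pi.single_apply, ite_smul]
  have h := pos_of_mem_intrinsicInterior (f := LinearMap.proj i ∘ₗ g) (y := v i) ?_
    (subset_convexHull ℝ (Set.range v) ⟨i, rfl⟩) ?_ hx
  · rwa [LinearMap.comp_apply, hg] at h
  · intro y hy
    obtain ⟨d, hd0, -, rfl⟩ := mem_convexHull_range.1 hy
    rw [LinearMap.comp_apply, hg]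
    exact hd0 i
  · rw [LinearMap.comp_apply, hvi, hg]
    simp

end SimplicialFace

open scoped ComplexConjugate ComplexOrder

namespace ThreeQubit

/-! ### A common form of the four witnesses -/

/-- The label opposite to `i` on the anti-diagonal. -/
def opp (i : Idx) : Idx := (1 - i.1, 1 - i.2.1, 1 - i.2.2)

theorem opp_opp (i : Idx) : opp (opp i) = i := by
  revert i; decide

theorem opp_ne (i : Idx) : opp i ≠ i := by
  revert i; decide

theorem sum_idx {M : Type*} [AddCommMonoid M] (f : Idx → M) :
    ∑ i, f i = f (0, 0, 0) + f (0, 0, 1) + (f (0, 1, 0) + f (0, 1, 1)) +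
      (f (1, 0, 0) + f (1, 0, 1) + (f (1, 1, 0) + f (1, 1, 1))) := by
  simp [Fintype.sum_prod_type]

/-- The squared moduli of the entries of `eta p q r j`. -/
noncomputable def weight (p q r : ℝ) (i : Idx) : ℝ :=
  (if i.1 = 0 then p else p⁻¹) * (if i.2.1 = 0 then q else q⁻¹) * (if i.2.2 = 0 then r else r⁻¹)

/-- The signs of the anti-diagonal entries of the witnesses. -/
noncomputable def antiSign (i : Idx) : ℝ := if i = (0, 1, 0) ∨ i = (1, 0, 1) then -1 else 1

/-- The diagonal entries of the witness whose diagonal vanishes at `b` and `opp b`. -/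
noncomputable def diagEntry (p q r : ℝ) (b i : Idx) : ℝ :=
  if i = b ∨ i = opp b then 0 else √8 * (weight p q r i)⁻¹

/-- The common form of the four witnesses. -/
noncomputable def xWitness (p q r : ℝ) (b : Idx) : Mat := Matrix.of fun i j =>
  (if j = i then ((diagEntry p q r b i : ℝ) : ℂ) else 0) +
    if j = opp i then ((3 * antiSign i : ℝ) : ℂ) else 0

/-! ### Entries of the four summands and of their triple sums -/

theorem flipA_conj (M : Mat) (i j : Idx) :
    (flipA * M * flipA) i j = M (1 - i.1, i.2) (1 - j.1, j.2) := by
  have h : ∀ i j, flipA i j = if i = (1 - j.1, j.2) then 1 else 0 := by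
    rintro ⟨i₁, i₂, i₃⟩ ⟨j₁, j₂, j₃⟩
    fin_cases i₁ <;> fin_cases i₂ <;> fin_cases i₃ <;> fin_cases j₁ <;> fin_cases j₂ <;>
      fin_cases j₃ <;> simp [flipA, bitFlip]
  have h' : ∀ i j, flipA i j = if j = (1 - i.1, i.2) then 1 else 0 := by
    intro i j
    rw [h]
    congr 1
    revert i j
    simp only [eq_iff_iff]
    decide
  simp only [Matrix.mul_apply, Finset.sum_mul]
  rw [Finset.sum_eq_single (1 - j.1, j.2), Finset.sum_eq_single (1 - i.1, i.2)]
  · simp [h]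
  · intro k _ hk
    simp [h' i, hk]
  · simp
  · intro k _ hk
    simp [h k j, hk]
  · simp

theorem flipB_conj (M : Mat) (i j : Idx) :
    (flipB * M * flipB) i j = M (i.1, 1 - i.2.1, i.2.2) (j.1, 1 - j.2.1, j.2.2) := by
  have h : ∀ i j, flipB i j = if i = (j.1, 1 - j.2.1, j.2.2) then 1 else 0 := by
    rintro ⟨i₁, i₂, i₃⟩ ⟨j₁, j₂, j₃⟩
    fin_cases i₁ <;> fin_cases i₂ <;> fin_cases i₃ <;> fin_cases j₁ <;> fin_cases j₂ <;>
      fin_cases j₃ <;> simp [flipB, bitFlip]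
  have h' : ∀ i j, flipB i j = if j = (i.1, 1 - i.2.1, i.2.2) then 1 else 0 := by
    intro i j
    rw [h]
    congr 1
    revert i j
    simp only [eq_iff_iff]
    decide
  simp only [Matrix.mul_apply, Finset.sum_mul]
  rw [Finset.sum_eq_single (j.1, 1 - j.2.1, j.2.2),
    Finset.sum_eq_single (i.1, 1 - i.2.1, i.2.2)]
  · simp [h]
  · intro k _ hk
    simp [h' i, hk]
  · simp
  · intro k _ hk
    simp [h k j, hk]
  · simp

theorem flipC_conj (M : Mat) (i j : Idx) :
    (flipC * M * flipC) i j = M (i.1, i.2.1, 1 - i.2.2) (j.1, j.2.1, 1 - j.2.2) := by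
  have h : ∀ i j, flipC i j = if i = (j.1, j.2.1, 1 - j.2.2) then 1 else 0 := by
    rintro ⟨i₁, i₂, i₃⟩ ⟨j₁, j₂, j₃⟩
    fin_cases i₁ <;> fin_cases i₂ <;> fin_cases i₃ <;> fin_cases j₁ <;> fin_cases j₂ <;>
      fin_cases j₃ <;> simp [flipC, bitFlip]
  have h' : ∀ i j, flipC i j = if j = (i.1, i.2.1, 1 - i.2.2) then 1 else 0 := by
    intro i j
    rw [h]
    congr 1
    revert i j
    simp only [eq_iff_iff]
    decide
  simp only [Matrix.mul_apply, Finset.sum_mul]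
  rw [Finset.sum_eq_single (j.1, j.2.1, 1 - j.2.2),
    Finset.sum_eq_single (i.1, i.2.1, 1 - i.2.2)]
  · simp [h]
  · intro k _ hk
    simp [h' i, hk]
  · simp
  · intro k _ hk
    simp [h k j, hk]
  · simp

/-- The diagonal of `W u`. -/
noncomputable def diagW (u : ℝ) (i : Idx) : ℝ :=
  if i = (0, 1, 1) then √8 * u⁻¹ else if i = (1, 0, 0) then √8 * u else 0

theorem W_apply (u : ℝ) (i j : Idx) : W u i j =
    (if j = i then ((diagW u i : ℝ) : ℂ) else 0) +
      if j = opp i then ((antiSign i : ℝ) : ℂ) else 0 := by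
  obtain ⟨i₁, i₂, i₃⟩ := i
  obtain ⟨j₁, j₂, j₃⟩ := j
  fin_cases i₁ <;> fin_cases i₂ <;> fin_cases i₃ <;> fin_cases j₁ <;> fin_cases j₂ <;>
    fin_cases j₃ <;> simp [W, lexPos, diagW, antiSign, opp]

/-- On the anti-diagonal the partial transpose and the bit flip of the same party undo each other,
so only the diagonal is permuted. -/
theorem WA_apply (u : ℝ) (i j : Idx) : WA u i j =
    (if j = i then ((diagW u (1 - i.1, i.2) : ℝ) : ℂ) else 0) +
      if j = opp i then ((antiSign i : ℝ) : ℂ) else 0 := by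
  rw [WA, flipA_conj, partialTranspose, Matrix.of_apply, W_apply]
  obtain ⟨i₁, i₂, i₃⟩ := i
  obtain ⟨j₁, j₂, j₃⟩ := j
  fin_cases i₁ <;> fin_cases i₂ <;> fin_cases i₃ <;> fin_cases j₁ <;> fin_cases j₂ <;>
    fin_cases j₃ <;> simp [diagW, antiSign, opp]

theorem WB_apply (u : ℝ) (i j : Idx) : WB u i j =
    (if j = i then ((diagW u (i.1, 1 - i.2.1, i.2.2) : ℝ) : ℂ) else 0) +
      if j = opp i then ((antiSign i : ℝ) : ℂ) else 0 := by
  rw [WB, flipB_conj, partialTranspose, Matrix.of_apply, W_apply]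
  obtain ⟨i₁, i₂, i₃⟩ := i
  obtain ⟨j₁, j₂, j₃⟩ := j
  fin_cases i₁ <;> fin_cases i₂ <;> fin_cases i₃ <;> fin_cases j₁ <;> fin_cases j₂ <;>
    fin_cases j₃ <;> simp [diagW, antiSign, opp]

theorem WC_apply (u : ℝ) (i j : Idx) : WC u i j =
    (if j = i then ((diagW u (i.1, i.2.1, 1 - i.2.2) : ℝ) : ℂ) else 0) +
      if j = opp i then ((antiSign i : ℝ) : ℂ) else 0 := by
  rw [WC, flipC_conj, partialTranspose, Matrix.of_apply, W_apply]
  obtain ⟨i₁, i₂, i₃⟩ := i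
  obtain ⟨j₁, j₂, j₃⟩ := j
  fin_cases i₁ <;> fin_cases i₂ <;> fin_cases i₃ <;> fin_cases j₁ <;> fin_cases j₂ <;>
    fin_cases j₃ <;> simp [diagW, antiSign, opp]

/-- The summands share their anti-diagonal, which is tripled; only the diagonals have to be matched.
-/
theorem add_eq_xWitness {p q r : ℝ} {b : Idx} {M₁ M₂ M₃ : Mat} {d₁ d₂ d₃ : Idx → ℝ}
    (h₁ : ∀ i j, M₁ i j = (if j = i then ((d₁ i : ℝ) : ℂ) else 0) +
      if j = opp i then ((antiSign i : ℝ) : ℂ) else 0)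
    (h₂ : ∀ i j, M₂ i j = (if j = i then ((d₂ i : ℝ) : ℂ) else 0) +
      if j = opp i then ((antiSign i : ℝ) : ℂ) else 0)
    (h₃ : ∀ i j, M₃ i j = (if j = i then ((d₃ i : ℝ) : ℂ) else 0) +
      if j = opp i then ((antiSign i : ℝ) : ℂ) else 0)
    (hd : ∀ i, d₁ i + d₂ i + d₃ i = diagEntry p q r b i) :
    M₁ + M₂ + M₃ = xWitness p q r b := by
  ext i j
  rw [Matrix.add_apply, Matrix.add_apply, h₁, h₂, h₃, xWitness, Matrix.of_apply, ← hd]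
  split_ifs <;> push_cast <;> ring

theorem W_add_WA_add_WB (u : ℝ) :
    W u + WA u + WB u = xWitness 1 1 u⁻¹ (0, 1, 0) := by
  refine add_eq_xWitness (W_apply u) (WA_apply u) (WB_apply u) ?_
  rintro ⟨i₁, i₂, i₃⟩
  fin_cases i₁ <;> fin_cases i₂ <;> fin_cases i₃ <;> simp [diagW, diagEntry, weight, opp]

theorem W_add_WB_add_WC (u : ℝ) :
    W u + WB u + WC u = xWitness u 1 1 (0, 0, 0) := by
  refine add_eq_xWitness (W_apply u) (WB_apply u) (WC_apply u) ?_
  rintro ⟨i₁, i₂, i₃⟩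
  fin_cases i₁ <;> fin_cases i₂ <;> fin_cases i₃ <;> simp [diagW, diagEntry, weight, opp]

theorem W_add_WC_add_WA (u : ℝ) :
    W u + WC u + WA u = xWitness 1 u⁻¹ 1 (0, 0, 1) := by
  refine add_eq_xWitness (W_apply u) (WC_apply u) (WA_apply u) ?_
  rintro ⟨i₁, i₂, i₃⟩
  fin_cases i₁ <;> fin_cases i₂ <;> fin_cases i₃ <;> simp [diagW, diagEntry, weight, opp]

theorem WA_add_WB_add_WC {u : ℝ} (hu : 0 < u) :
    WA u + WB u + WC u = xWitness u u⁻¹ u⁻¹ (0, 1, 1) := by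
  refine add_eq_xWitness (WA_apply u) (WB_apply u) (WC_apply u) ?_
  rintro ⟨i₁, i₂, i₃⟩
  fin_cases i₁ <;> fin_cases i₂ <;> fin_cases i₃ <;>
    simp [diagW, diagEntry, weight, opp, hu.ne']

theorem antiSign_opp (i : Idx) : antiSign (opp i) = antiSign i := by
  obtain ⟨i₁, i₂, i₃⟩ := i
  fin_cases i₁ <;> fin_cases i₂ <;> fin_cases i₃ <;> simp [antiSign, opp]

theorem isHermitian_xWitness (p q r : ℝ) (b : Idx) : (xWitness p q r b).IsHermitian := by
  ext i j
  have hopp : i = opp j ↔ j = opp i :=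
    ⟨fun h => by rw [h, opp_opp], fun h => by rw [h, opp_opp]⟩
  simp only [xWitness, Matrix.conjTranspose_apply, Matrix.of_apply, star_add, hopp,
    eq_comm (a := i) (b := j), RCLike.star_def]
  by_cases h1 : j = i
  · subst h1
    simp [(opp_ne _).symm]
  · by_cases h2 : j = opp i
    · subst h2
      simp only [h1, if_false, if_true, antiSign_opp, map_zero, Complex.conj_ofReal]
    · simp [h1, h2]

/-- The value of the witness `xWitness p q r b` on the vector `ξ`. -/
noncomputable def witnessForm (p q r : ℝ) (b : Idx) (ξ : Idx → ℂ) : ℝ :=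
  ∑ i, diagEntry p q r b i * ‖ξ i‖ ^ 2 + 3 * ∑ i, antiSign i * (ξ i * conj (ξ (opp i))).re

theorem pairing_xWitness (p q r : ℝ) (b : Idx) (ξ : Idx → ℂ) :
    pairing (xWitness p q r b) (Matrix.vecMulVec ξ (star ξ)) = (witnessForm p q r b ξ : ℝ) := by
  have h1 : pairing (xWitness p q r b) (Matrix.vecMulVec ξ (star ξ)) =
      ∑ i, (diagEntry p q r b i : ℂ) * (ξ i * conj (ξ i)) +
        3 * ∑ i, (antiSign i : ℂ) * (ξ i * conj (ξ (opp i))) := by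
    simp only [pairing, Matrix.trace, Matrix.diag_apply, Matrix.mul_apply,
      Matrix.transpose_apply, xWitness, Matrix.of_apply, Matrix.vecMulVec_apply, mul_add,
      Finset.sum_add_distrib, mul_ite, mul_zero, Finset.sum_ite_eq',
      Finset.mem_univ, if_true, Finset.mul_sum, Pi.star_apply, RCLike.star_def]
    congr 1
    · exact Finset.sum_congr rfl fun i _ => by ring
    · exact Finset.sum_congr rfl fun i _ => by push_cast; ring
  -- The terms at `i` and `opp i` are complex conjugates, so the sum is real.
  have h2 : ∑ i, (antiSign i : ℂ) * (ξ i * conj (ξ (opp i))) =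
      ((∑ i, antiSign i * (ξ i * conj (ξ (opp i))).re : ℝ) : ℂ) := by
    apply Complex.ext
    · simp
    · simp only [sum_idx, antiSign, opp]
      simp
      ring
  rw [h1, h2, witnessForm]
  push_cast
  congr 1
  refine Finset.sum_congr rfl fun i _ => ?_
  rw [Complex.mul_conj, Complex.normSq_eq_norm_sq]
  push_cast
  rfl

/-! ### Zeros of the witnesses on product vectors -/

theorem weight_pos {p q r : ℝ} (hp : 0 < p) (hq : 0 < q) (hr : 0 < r) (i : Idx) :
    0 < weight p q r i := by
  unfold weight
  split_ifs <;> positivity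

theorem weight_mul_weight_opp {p q r : ℝ} (hp : 0 < p) (hq : 0 < q) (hr : 0 < r) (i : Idx) :
    weight p q r i * weight p q r (opp i) = 1 := by
  obtain ⟨i₁, i₂, i₃⟩ := i
  fin_cases i₁ <;> fin_cases i₂ <;> fin_cases i₃ <;> simp [weight, opp] <;> field_simp

theorem weight_one (i : Idx) : weight 1 1 1 i = 1 := by
  simp [weight]

/-- Rescaling by the square roots of the weights reduces the witnesses to `p = q = r = 1`. -/
theorem witnessForm_sqrt_weight_mul {p q r : ℝ} (hp : 0 < p) (hq : 0 < q) (hr : 0 < r) (b : Idx)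
    (ξ : Idx → ℂ) : witnessForm p q r b (fun i => (√(weight p q r i) : ℂ) * ξ i) =
      witnessForm 1 1 1 b ξ := by
  unfold witnessForm
  congr 1
  · refine Finset.sum_congr rfl fun i _ => ?_
    have hw := weight_pos hp hq hr i
    rw [norm_mul, Complex.norm_real, Real.norm_eq_abs, abs_of_nonneg (Real.sqrt_nonneg _),
      mul_pow, Real.sq_sqrt hw.le, diagEntry, diagEntry, weight_one]
    split_ifs
    · simp
    · field_simp
  · congr 1
    refine Finset.sum_congr rfl fun i _ => ?_
    -- Opposite weights are reciprocal, so the rescaling leaves the anti-diagonal terms unchanged.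
    have hw : (√(weight p q r i) : ℂ) * √(weight p q r (opp i)) = 1 := by
      rw [← Complex.ofReal_mul, ← Real.sqrt_mul (weight_pos hp hq hr i).le,
        weight_mul_weight_opp hp hq hr]
      simp
    congr 2
    rw [map_mul, Complex.conj_ofReal]
    linear_combination (ξ i * conj (ξ (opp i))) * hw

/-- With `X = x 0 * conj (x 1)` and likewise `Y`, `Z`, the sum is twice the real part of `XYZ + XYZ̄
- XȲZ + XȲZ̄`. The first two terms combine to `2 Re(XY) Re Z`, the last two to `2 Im(XȲ) Im Z`. -/
theorem sum_antiSign_prodVec (x y z : Fin 2 → ℂ) :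
    ∑ i, antiSign i * (prodVec x y z i * conj (prodVec x y z (opp i))).re =
      4 * ((x 0 * conj (x 1) * (y 0 * conj (y 1))).re * (z 0 * conj (z 1)).re +
        (x 0 * conj (x 1) * conj (y 0 * conj (y 1))).im * (z 0 * conj (z 1)).im) := by
  simp only [sum_idx, antiSign, opp, prodVec]
  simp
  ring

/-- Cauchy-Schwarz against `(Re Z, Im Z)`; each of the two coefficients is at most `‖X‖ ‖Y‖` in
modulus, whence the factor 2. -/
theorem cross_sq_le (X Y Z : ℂ) :
    ((X * Y).re * Z.re + (X * conj Y).im * Z.im) ^ 2 ≤ 2 * (‖X‖ * ‖Y‖ * ‖Z‖) ^ 2 := by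
  have hc : (X * Y).re ^ 2 ≤ (‖X‖ * ‖Y‖) ^ 2 := by
    rw [← norm_mul]
    exact sq_le_sq' (neg_le_of_abs_le (Complex.abs_re_le_norm _))
      (le_of_abs_le (Complex.abs_re_le_norm _))
  have hs : (X * conj Y).im ^ 2 ≤ (‖X‖ * ‖Y‖) ^ 2 := by
    rw [← Complex.norm_conj Y, ← norm_mul]
    exact sq_le_sq' (neg_le_of_abs_le (Complex.abs_im_le_norm _))
      (le_of_abs_le (Complex.abs_im_le_norm _))
  have hz : ‖Z‖ ^ 2 = Z.re ^ 2 + Z.im ^ 2 := by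
    rw [← Complex.normSq_eq_norm_sq, Complex.normSq_apply]; ring
  rw [mul_pow _ ‖Z‖, hz]
  generalize (X * Y).re = c at *
  generalize (X * conj Y).im = s at *
  nlinarith [sq_nonneg (c * Z.im - s * Z.re), mul_le_mul_of_nonneg_right hc (sq_nonneg Z.re),
    mul_le_mul_of_nonneg_right hc (sq_nonneg Z.im), mul_le_mul_of_nonneg_right hs (sq_nonneg Z.re),
    mul_le_mul_of_nonneg_right hs (sq_nonneg Z.im)]

theorem sqrt_eight : √8 = 2 * √2 := by
  rw [show (8 : ℝ) = 2 ^ 2 * 2 by norm_num, Real.sqrt_mul (by positivity),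
    Real.sqrt_sq (by positivity)]

theorem norm_prodVec_mul_norm_opp (x y z : Fin 2 → ℂ) (i : Idx) :
    ‖prodVec x y z i‖ * ‖prodVec x y z (opp i)‖ =
      ‖x 0 * conj (x 1)‖ * ‖y 0 * conj (y 1)‖ * ‖z 0 * conj (z 1)‖ := by
  obtain ⟨i₁, i₂, i₃⟩ := i
  fin_cases i₁ <;> fin_cases i₂ <;> fin_cases i₃ <;> simp [prodVec, opp] <;> ring

theorem neg_sqrt_le_sum_antiSign_prodVec (x y z : Fin 2 → ℂ) (k : Idx) :
    0 ≤ ∑ i, antiSign i * (prodVec x y z i * conj (prodVec x y z (opp i))).re +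
      2 * √8 * (‖prodVec x y z k‖ * ‖prodVec x y z (opp k)‖) := by
  rw [sum_antiSign_prodVec, norm_prodVec_mul_norm_opp, sqrt_eight]
  have h := cross_sq_le (x 0 * conj (x 1)) (y 0 * conj (y 1)) (z 0 * conj (z 1))
  set m := ‖x 0 * conj (x 1)‖ * ‖y 0 * conj (y 1)‖ * ‖z 0 * conj (z 1)‖ with hm
  have h2 : 2 * m ^ 2 = (√2 * m) ^ 2 := by rw [mul_pow √2 m, Real.sq_sqrt (by norm_num)]
  rw [h2] at h
  have := abs_le_of_sq_le_sq' h (by positivity)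
  linarith [this.1]

/-- AM-GM with its defect: `N² + N'² = (N - N')² + 2m` for each of the three pairs off `b`. The
factor 1/2 is there because the sum over labels meets every pair twice. -/
theorem sum_diagEntry_one (b : Idx) {N : Idx → ℝ} {m : ℝ} (hN : ∀ i, N i * N (opp i) = m) :
    ∑ i, diagEntry 1 1 1 b i * N i ^ 2 =
      √8 / 2 * ∑ i, (if i = b ∨ i = opp b then 0 else (N i - N (opp i)) ^ 2) + 6 * √8 * m := by
  have h0 := hN (0, 0, 0)
  have h1 := hN (0, 0, 1)
  have h2 := hN (0, 1, 0)
  have h3 := hN (0, 1, 1)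
  obtain ⟨b₁, b₂, b₃⟩ := b
  fin_cases b₁ <;> fin_cases b₂ <;> fin_cases b₃ <;>
    simp [sum_idx, diagEntry, opp, weight] at h0 h1 h2 h3 ⊢ <;>
    first
    | linear_combination 2 * √8 * h1 + 2 * √8 * h2 + 2 * √8 * h3
    | linear_combination 2 * √8 * h0 + 2 * √8 * h2 + 2 * √8 * h3
    | linear_combination 2 * √8 * h0 + 2 * √8 * h1 + 2 * √8 * h3
    | linear_combination 2 * √8 * h0 + 2 * √8 * h1 + 2 * √8 * h2

/-- The witness form on a product vector, as a sum of nonnegative terms. -/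
theorem witnessForm_one_prodVec (x y z : Fin 2 → ℂ) (b : Idx) :
    witnessForm 1 1 1 b (prodVec x y z) =
      √8 / 2 * ∑ i, (if i = b ∨ i = opp b then 0 else
        (‖prodVec x y z i‖ - ‖prodVec x y z (opp i)‖) ^ 2) +
      3 * (∑ i, antiSign i * (prodVec x y z i * conj (prodVec x y z (opp i))).re +
        2 * √8 * (‖prodVec x y z b‖ * ‖prodVec x y z (opp b)‖)) := by
  rw [witnessForm, norm_prodVec_mul_norm_opp x y z b,
    sum_diagEntry_one b (norm_prodVec_mul_norm_opp x y z)]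
  ring

theorem witnessForm_one_prodVec_nonneg (x y z : Fin 2 → ℂ) (b : Idx) :
    0 ≤ witnessForm 1 1 1 b (prodVec x y z) := by
  rw [witnessForm_one_prodVec]
  have h1 := neg_sqrt_le_sum_antiSign_prodVec x y z b
  have h2 : 0 ≤ ∑ i, (if i = b ∨ i = opp b then 0 else
      (‖prodVec x y z i‖ - ‖prodVec x y z (opp i)‖) ^ 2) := by
    refine Finset.sum_nonneg fun i _ => ?_
    split_ifs <;> positivity
  positivity

/-- The equality case: both nonnegative parts of `witnessForm_one_prodVec` must vanish. -/
theorem norm_eq_of_witnessForm_eq_zero {x y z : Fin 2 → ℂ} {b : Idx}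
    (h : witnessForm 1 1 1 b (prodVec x y z) = 0) :
    (∀ i, i ≠ b → i ≠ opp b → ‖prodVec x y z i‖ = ‖prodVec x y z (opp i)‖) ∧
    ∑ i, antiSign i * (prodVec x y z i * conj (prodVec x y z (opp i))).re =
      -(2 * √8 * (‖prodVec x y z b‖ * ‖prodVec x y z (opp b)‖)) := by
  rw [witnessForm_one_prodVec] at h
  have h1 := neg_sqrt_le_sum_antiSign_prodVec x y z b
  have h0 : ∀ i ∈ Finset.univ, 0 ≤ (if i = b ∨ i = opp b then 0 else
      (‖prodVec x y z i‖ - ‖prodVec x y z (opp i)‖) ^ 2) := by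
    intro i _
    split_ifs <;> positivity
  have h2 := Finset.sum_nonneg h0
  have h8 : 0 < √8 / 2 := by positivity
  have h3 := mul_nonneg h8.le h2
  have h4 : √8 / 2 * ∑ i, (if i = b ∨ i = opp b then 0 else
      (‖prodVec x y z i‖ - ‖prodVec x y z (opp i)‖) ^ 2) = 0 := by linarith
  have h5 := (Finset.sum_eq_zero_iff_of_nonneg h0).1 ((mul_eq_zero.1 h4).resolve_left h8.ne')
  refine ⟨fun i hi hi' => ?_, by linarith⟩
  have h6 := h5 i (Finset.mem_univ i)
  rw [if_neg (by tauto)] at h6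
  exact sub_eq_zero.1 (pow_eq_zero_iff (by norm_num) |>.1 h6)

theorem eq_of_mul_eq_mul_of_swap {a a' b b' : ℝ} (ha' : 0 < a') (hb : 0 < b) (hb' : 0 < b')
    (h₁ : a * b = a' * b') (h₂ : a * b' = a' * b) : a = a' ∧ b = b' := by
  have h : a = a' := by
    have h3 : (a - a') * (b + b') = 0 := by linear_combination h₁ + h₂
    exact sub_eq_zero.1 ((mul_eq_zero.1 h3).resolve_right (by positivity))
  refine ⟨h, ?_⟩
  rw [h] at h₁
  exact mul_left_cancel₀ ha'.ne' h₁

/-- In the logarithms of the ratios `a / a'`, `b / b'`, `c / c'` these are three independent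
homogeneous linear equations with coefficients ±1. -/
theorem eq_of_three_mul_eq_mul {a a' b b' c c' : ℝ} (ha' : 0 < a') (hb : 0 < b)
    (hb' : 0 < b') (hc : 0 < c) (hc' : 0 < c') (h₁ : a * b * c = a' * b' * c')
    (h₂ : a * b * c' = a' * b' * c)
    (h₃ : a * b' * c = a' * b * c' ∨ a * b' * c' = a' * b * c) : a = a' ∧ b = b' ∧ c = c' := by
  obtain ⟨hab, rfl⟩ := eq_of_mul_eq_mul_of_swap (by positivity) hc hc' h₁ h₂
  have h : a * b' = a' * b := mul_right_cancel₀ hc.ne' (h₃.elim id id)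
  obtain ⟨rfl, rfl⟩ := eq_of_mul_eq_mul_of_swap ha' hb hb' hab h
  exact ⟨rfl, rfl, rfl⟩

/-- Three of the four equations between opposite entries of a positive product vector force
its factors to be constant. -/
theorem factors_const {X Y Z : Fin 2 → ℝ} (hX : ∀ i, 0 < X i) (hY : ∀ i, 0 < Y i)
    (hZ : ∀ i, 0 < Z i) {b : Idx}
    (h : ∀ i : Idx, i ≠ b → i ≠ opp b →
      X i.1 * Y i.2.1 * Z i.2.2 = X (opp i).1 * Y (opp i).2.1 * Z (opp i).2.2) :
    X 0 = X 1 ∧ Y 0 = Y 1 ∧ Z 0 = Z 1 := by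
  have h0 := h (0, 0, 0)
  have h1 := h (0, 0, 1)
  have h2 := h (0, 1, 0)
  have h3 := h (0, 1, 1)
  have key := eq_of_three_mul_eq_mul (a := X 0) (hX 1) (hY 0) (hY 1) (hZ 0) (hZ 1)
  -- When the missing equation is that of `000` or `001`, the two entries of the middle factor
  -- exchange roles.
  have key' := fun h₁ h₂ h₃ => (eq_of_three_mul_eq_mul (a := X 0) (hX 1) (hY 1) (hY 0) (hZ 0)
    (hZ 1) h₁ h₂ h₃).imp_right (And.imp_left Eq.symm)
  obtain ⟨b₁, b₂, b₃⟩ := b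
  fin_cases b₁ <;> fin_cases b₂ <;> fin_cases b₃ <;> simp [opp] at h0 h1 h2 h3 <;>
    first
    | exact key h0 h1 (.inl h2)
    | exact key h0 h1 (.inr h3)
    | exact key' h2 h3 (.inl h0)
    | exact key' h2 h3 (.inr h1)

/-! ### The phase triples -/

/-- The complex number `(s + t i) / √2`. -/
noncomputable def diagPhase (s t : ℝ) : ℂ := ⟨s * (√2 / 2), t * (√2 / 2)⟩

theorem ω_eq : ω = diagPhase 1 1 := by
  rw [ω, mul_comm, Complex.exp_mul_I]
  rw [show (Real.pi / 4 : ℂ) = ((Real.pi / 4 : ℝ) : ℂ) by push_cast; rfl, ← Complex.ofReal_cos,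
    ← Complex.ofReal_sin, Real.cos_pi_div_four, Real.sin_pi_div_four]
  apply Complex.ext <;> simp [diagPhase]

theorem sqrt_two_div_two_sq : (√2 / 2) ^ 2 = 1 / 2 := by
  rw [div_pow, Real.sq_sqrt (by norm_num)]
  norm_num

theorem ω_sq : ω ^ 2 = Complex.I := by
  have h := sqrt_two_div_two_sq
  rw [ω_eq, sq]
  apply Complex.ext <;> simp [diagPhase]
  linear_combination 2 * h

theorem ω_pow_three : ω ^ 3 = diagPhase (-1) 1 := by
  rw [pow_succ, ω_sq, ω_eq]
  apply Complex.ext <;> simp [diagPhase]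

theorem ω_pow_seven : ω ^ 7 = diagPhase 1 (-1) := by
  rw [show ω ^ 7 = (ω ^ 2) ^ 3 * ω by ring, ω_sq, ω_eq, Complex.I_pow_three]
  apply Complex.ext <;> simp [diagPhase]

theorem neg_diagPhase (s t : ℝ) : -diagPhase s t = diagPhase (-s) (-t) := by
  apply Complex.ext <;> simp [diagPhase]

theorem star_diagPhase (s t : ℝ) : star (diagPhase s t) = diagPhase s (-t) := by
  apply Complex.ext <;> simp [diagPhase]

theorem phase_eq : phase =
    ![![diagPhase (-1) 1, diagPhase 1 1, diagPhase 1 (-1)],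
      ![diagPhase (-1) 1, diagPhase (-1) (-1), diagPhase (-1) 1],
      ![diagPhase 1 (-1), diagPhase 1 1, diagPhase (-1) 1],
      ![diagPhase 1 (-1), diagPhase (-1) (-1), diagPhase 1 (-1)],
      ![diagPhase (-1) (-1), diagPhase 1 (-1), diagPhase 1 1],
      ![diagPhase (-1) (-1), diagPhase (-1) 1, diagPhase (-1) (-1)],
      ![diagPhase 1 1, diagPhase 1 (-1), diagPhase (-1) (-1)],
      ![diagPhase 1 1, diagPhase (-1) 1, diagPhase 1 1]] := by
  rw [phase, ω_pow_three, ω_pow_seven, ω_eq]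
  funext j k
  fin_cases j <;> fin_cases k <;>
    simp [neg_diagPhase, star_diagPhase,
      -RCLike.star_def]

/-- Unit phases that minimize the anti-diagonal part of the witness form one of the eight phase
triples. -/
theorem exists_phase_eq {α β γ : ℂ} (hα : ‖α‖ = 1) (hβ : ‖β‖ = 1) (hγ : ‖γ‖ = 1)
    (h : (conj α * conj β).re * (conj γ).re + (conj α * conj (conj β)).im * (conj γ).im = -√2) :
    ∃ j, α = phase j 0 ∧ β = phase j 1 ∧ γ = phase j 2 := by
  obtain ⟨a₁, a₂⟩ := α
  obtain ⟨b₁, b₂⟩ := β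
  obtain ⟨c₁, c₂⟩ := γ
  have unit : ∀ {s t : ℝ}, ‖(⟨s, t⟩ : ℂ)‖ = 1 → s ^ 2 + t ^ 2 = 1 := by
    intro s t h
    have := Complex.normSq_eq_norm_sq ⟨s, t⟩
    rw [h, Complex.normSq_mk] at this
    linarith
  replace hα := unit hα
  replace hβ := unit hβ
  replace hγ := unit hγ
  simp at h
  have hsq : √2 ^ 2 = 2 := Real.sq_sqrt (by norm_num)
  obtain ⟨c, hc⟩ : ∃ c, c = a₁ * b₁ - a₂ * b₂ := ⟨_, rfl⟩
  obtain ⟨s, hs⟩ : ∃ s, s = a₁ * b₂ - a₂ * b₁ := ⟨_, rfl⟩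
  have hcs : c * c₁ - s * c₂ = -√2 := by rw [hc, hs]; linear_combination h
  have hc1 : c ^ 2 + (a₁ * b₂ + a₂ * b₁) ^ 2 = 1 := by
    rw [hc]; linear_combination (b₁ ^ 2 + b₂ ^ 2) * hα + hβ
  have hs1 : s ^ 2 + (a₁ * b₁ + a₂ * b₂) ^ 2 = 1 := by
    rw [hs]; linear_combination (b₁ ^ 2 + b₂ ^ 2) * hα + hβ
  -- Lagrange's identity with `‖γ‖ = 1`. Together with `c² ≤ 1` and `s² ≤ 1` it forces `c² = s² = 1`
  -- and makes the last square vanish, which determines `γ`.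
  have hsum : c ^ 2 + s ^ 2 = 2 + (s * c₁ + c * c₂) ^ 2 := by
    linear_combination -(c ^ 2 + s ^ 2) * hγ + (c * c₁ - s * c₂ - √2) * hcs + hsq
  have hc2 : c ^ 2 = 1 := by
    nlinarith [sq_nonneg (s * c₁ + c * c₂), sq_nonneg (a₁ * b₂ + a₂ * b₁),
      sq_nonneg (a₁ * b₁ + a₂ * b₂)]
  have hs2 : s ^ 2 = 1 := by
    nlinarith [sq_nonneg (s * c₁ + c * c₂), sq_nonneg (a₁ * b₂ + a₂ * b₁),
      sq_nonneg (a₁ * b₁ + a₂ * b₂)]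
  have horth : s * c₁ + c * c₂ = 0 := by
    refine pow_eq_zero_iff (two_ne_zero) |>.1 ?_
    linarith
  have hγ1 : c₁ = -c * (√2 / 2) := by
    linear_combination (c / 2) * hcs + (s / 2) * horth - (c₁ / 2) * hc2 - (c₁ / 2) * hs2
  have hγ2 : c₂ = s * (√2 / 2) := by
    linear_combination (-s / 2) * hcs + (c / 2) * horth - (c₂ / 2) * hc2 - (c₂ / 2) * hs2
  -- As `c = Re(αβ)` is ±1, `β = c ᾱ`: the squared distance of the two is `1 + c² - 2c² = 0`.
  have hβ1 : b₁ = c * a₁ ∧ b₂ = -c * a₂ := by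
    have h0 : (b₁ - c * a₁) ^ 2 + (b₂ + c * a₂) ^ 2 = 0 := by
      linear_combination hβ + c ^ 2 * hα - hc2 + 2 * c * hc
    have h1 := sq_nonneg (b₁ - c * a₁)
    have h2 := sq_nonneg (b₂ + c * a₂)
    have h3 := (pow_eq_zero_iff two_ne_zero).1 (show (b₁ - c * a₁) ^ 2 = 0 by linarith)
    have h4 := (pow_eq_zero_iff two_ne_zero).1 (show (b₂ + c * a₂) ^ 2 = 0 by linarith)
    exact ⟨by linarith, by linarith⟩
  obtain ⟨rfl, rfl⟩ := hβ1
  have hs3 : s = -2 * c * (a₁ * a₂) := by rw [hs]; ring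
  -- The condition `s² = 1` now makes the coordinates of `α` equal in modulus, so `α` is a primitive
  -- eighth root of unity.
  have h14 : (a₁ * a₂) ^ 2 = 1 / 4 := by
    rw [hs3] at hs2
    linear_combination (1 / 4) * hs2 - (a₁ * a₂) ^ 2 * hc2
  have hdiff : a₁ ^ 2 - a₂ ^ 2 = 0 := by
    refine pow_eq_zero_iff (two_ne_zero) |>.1 ?_
    linear_combination (a₁ ^ 2 + a₂ ^ 2 + 1) * hα - 4 * h14
  have hh := sqrt_two_div_two_sq
  have ha1 : a₁ ^ 2 = (√2 / 2) ^ 2 := by linarith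
  have ha2 : a₂ ^ 2 = (√2 / 2) ^ 2 := by linarith
  have hc3 : c ^ 2 = 1 ^ 2 := by linarith
  clear h hc hs hcs hc1 hs1 hsum hc2 hs2 horth hα hβ hγ h14 hdiff unit
  rw [hγ1, hγ2, hs3]
  clear hγ1 hγ2 hs3
  have key : ∀ s t : ℝ, s * (√2 / 2) * (t * (√2 / 2)) = s * t / 2 := by
    intro s t
    linear_combination s * t * hh
  have hpm : ∀ a, a ^ 2 = (√2 / 2) ^ 2 → a = 1 * (√2 / 2) ∨ a = (-1) * (√2 / 2) := by
    intro a ha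
    rcases sq_eq_sq_iff_eq_or_eq_neg.1 ha with h | h
    · left; linarith
    · right; linarith
  have close : ∀ s t a b : ℝ, a = s * (√2 / 2) → b = t * (√2 / 2) →
      (⟨a, b⟩ : ℂ) = diagPhase s t := by
    rintro s t a b rfl rfl
    rfl
  rw [phase_eq]
  -- Four values of `α` and two of `c` give the eight triples.
  rcases hpm _ ha1 with rfl | rfl <;> rcases hpm _ ha2 with rfl | rfl <;>
    rcases sq_eq_sq_iff_eq_or_eq_neg.1 hc3 with rfl | rfl <;> rw [key]
  · exact ⟨6, close _ _ _ _ (by ring) (by ring), close _ _ _ _ (by ring) (by ring),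
      close _ _ _ _ (by ring) (by ring)⟩
  · exact ⟨7, close _ _ _ _ (by ring) (by ring), close _ _ _ _ (by ring) (by ring),
      close _ _ _ _ (by ring) (by ring)⟩
  · exact ⟨2, close _ _ _ _ (by ring) (by ring), close _ _ _ _ (by ring) (by ring),
      close _ _ _ _ (by ring) (by ring)⟩
  · exact ⟨3, close _ _ _ _ (by ring) (by ring), close _ _ _ _ (by ring) (by ring),
      close _ _ _ _ (by ring) (by ring)⟩
  · exact ⟨1, close _ _ _ _ (by ring) (by ring), close _ _ _ _ (by ring) (by ring),
      close _ _ _ _ (by ring) (by ring)⟩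
  · exact ⟨0, close _ _ _ _ (by ring) (by ring), close _ _ _ _ (by ring) (by ring),
      close _ _ _ _ (by ring) (by ring)⟩
  · exact ⟨5, close _ _ _ _ (by ring) (by ring), close _ _ _ _ (by ring) (by ring),
      close _ _ _ _ (by ring) (by ring)⟩
  · exact ⟨4, close _ _ _ _ (by ring) (by ring), close _ _ _ _ (by ring) (by ring),
      close _ _ _ _ (by ring) (by ring)⟩

theorem norm_phase (j : Fin 8) (k : Fin 3) : ‖phase j k‖ = 1 := by
  have key : ∀ s t : ℝ, s ^ 2 = 1 → t ^ 2 = 1 → ‖diagPhase s t‖ = 1 := by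
    intro s t hs ht
    rw [← sq_eq_sq₀ (norm_nonneg _) zero_le_one, ← Complex.normSq_eq_norm_sq, diagPhase,
      Complex.normSq_mk]
    linear_combination (s ^ 2 + t ^ 2) * sqrt_two_div_two_sq + (1 / 2) * hs + (1 / 2) * ht
  rw [phase_eq]
  fin_cases j <;> fin_cases k <;> exact key _ _ (by norm_num) (by norm_num)

theorem phase_cross (j : Fin 8) :
    (conj (phase j 0) * conj (phase j 1)).re * (conj (phase j 2)).re +
      (conj (phase j 0) * conj (conj (phase j 1))).im * (conj (phase j 2)).im = -√2 := by
  have hh := sqrt_two_div_two_sq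
  rw [phase_eq]
  fin_cases j <;> simp [diagPhase] <;> linear_combination (-2 * √2) * hh

/-! ### Zeros on product vectors -/

/-- Each factor becomes `(√p, α / √p)` once the normalization is distributed, so `eta` is the local
rescaling of a vector of pure phases. -/
theorem eta_apply {p q r : ℝ} (hp : 0 < p) (hq : 0 < q) (hr : 0 < r) (j : Fin 8) (i : Idx) :
    eta p q r j i = √(weight p q r i) *
      prodVec ![1, phase j 0] ![1, phase j 1] ![1, phase j 2] i := by
  have hp' := Real.sqrt_pos.2 hp
  have hq' := Real.sqrt_pos.2 hq
  have hr' := Real.sqrt_pos.2 hr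
  have ep : (p : ℂ) = (√p : ℂ) ^ 2 := by
    rw [← Complex.ofReal_pow, Real.sq_sqrt hp.le]
  have eq : (q : ℂ) = (√q : ℂ) ^ 2 := by
    rw [← Complex.ofReal_pow, Real.sq_sqrt hq.le]
  have er : (r : ℂ) = (√r : ℂ) ^ 2 := by
    rw [← Complex.ofReal_pow, Real.sq_sqrt hr.le]
  have np : (√p : ℂ) ≠ 0 := by exact_mod_cast hp'.ne'
  have nq : (√q : ℂ) ≠ 0 := by exact_mod_cast hq'.ne'
  have nr : (√r : ℂ) ≠ 0 := by exact_mod_cast hr'.ne'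
  obtain ⟨i₁, i₂, i₃⟩ := i
  fin_cases i₁ <;> fin_cases i₂ <;> fin_cases i₃ <;>
    simp [eta, prodVec, weight, Real.sqrt_mul, hp.le, hq.le, mul_nonneg] <;>
      (try simp only [ep, eq, er]) <;> (try field_simp)
  exact Or.inl trivial

theorem witnessForm_eta {p q r : ℝ} (hp : 0 < p) (hq : 0 < q) (hr : 0 < r) (b : Idx) (j : Fin 8) :
    witnessForm p q r b (eta p q r j) = 0 := by
  rw [funext (eta_apply hp hq hr j), witnessForm_sqrt_weight_mul hp hq hr, witnessForm_one_prodVec,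
    sum_antiSign_prodVec]
  have hn : ∀ i, ‖prodVec ![1, phase j 0] ![1, phase j 1] ![1, phase j 2] i‖ = 1 := by
    rintro ⟨i₁, i₂, i₃⟩
    fin_cases i₁ <;> fin_cases i₂ <;> fin_cases i₃ <;> simp [prodVec, norm_phase]
  have h := phase_cross j
  simp only [hn, sub_self, Matrix.cons_val_zero, Matrix.cons_val_one, one_mul, sqrt_eight]
  rw [h]
  simp
  ring

theorem witnessForm_single (p q r : ℝ) {b i : Idx} (hi : i = b ∨ i = opp b) :
    witnessForm p q r b (Pi.single i 1) = 0 := by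
  rw [witnessForm, Finset.sum_eq_zero, Finset.sum_eq_zero]
  · simp
  · intro k _
    by_cases hk : k = i
    · subst hk
      simp [opp_ne]
    · simp [hk]
  · intro k _
    by_cases hk : k = i
    · subst hk
      simp [diagEntry, hi]
    · simp [hk]

/-- The zeros of the witness with `p = q = r = 1` on product vectors. -/
theorem prodVec_of_witnessForm_one_eq_zero {x y z : Fin 2 → ℂ} {b : Idx}
    (h : witnessForm 1 1 1 b (prodVec x y z) = 0) :
    (∃ c : ℂ, prodVec x y z = c • Pi.single b 1) ∨
    (∃ c : ℂ, prodVec x y z = c • Pi.single (opp b) 1) ∨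
    ∃ (j : Fin 8) (c : ℂ), prodVec x y z =
      c • prodVec ![1, phase j 0] ![1, phase j 1] ![1, phase j 2] := by
  obtain ⟨hnorm, hcross⟩ := norm_eq_of_witnessForm_eq_zero h
  have hm := norm_prodVec_mul_norm_opp x y z
  by_cases hm0 : ‖x 0 * conj (x 1)‖ * ‖y 0 * conj (y 1)‖ * ‖z 0 * conj (z 1)‖ = 0
  -- Off `b` and `opp b` opposite moduli agree and have product zero; of the two remaining entries
  -- at least one vanishes as well.
  · have hzero : ∀ i, i ≠ b → i ≠ opp b → prodVec x y z i = 0 := by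
      intro i hi hi'
      have := hm i
      rw [hm0, ← hnorm i hi hi', mul_self_eq_zero, norm_eq_zero] at this
      exact this
    have hb := hm b
    rw [hm0, mul_eq_zero, norm_eq_zero, norm_eq_zero] at hb
    rcases hb with hb | hb
    · refine Or.inr (Or.inl ⟨prodVec x y z (opp b), funext fun i => ?_⟩)
      by_cases hi : i = opp b
      · simp [hi]
      · by_cases hi' : i = b
        · simp [hi', hb, (opp_ne b).symm]
        · simp [hi, hzero i hi' hi]
    · refine Or.inl ⟨prodVec x y z b, funext fun i => ?_⟩
      by_cases hi : i = b
      · simp [hi]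
      · by_cases hi' : i = opp b
        · simp [hi', hb, opp_ne b]
        · simp [hi, hzero i hi hi']
  · refine Or.inr (Or.inr ?_)
    simp only [norm_mul, mul_eq_zero, norm_eq_zero, not_or,
      map_eq_zero] at hm0
    obtain ⟨⟨⟨hx0, hx1⟩, hy0, hy1⟩, hz0, hz1⟩ := hm0
    have pos : ∀ {w : Fin 2 → ℂ}, w 0 ≠ 0 → w 1 ≠ 0 → ∀ i, 0 < ‖w i‖ := by
      intro w h0 h1 i
      fin_cases i
      · exact norm_pos_iff.2 h0
      · exact norm_pos_iff.2 h1
    obtain ⟨hx, hy, hz⟩ := factors_const (X := fun i => ‖x i‖) (Y := fun i => ‖y i‖)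
      (Z := fun i => ‖z i‖) (b := b) (pos hx0 hx1) (pos hy0 hy1) (pos hz0 hz1)
      (fun i hi hi' => by simpa [prodVec] using hnorm i hi hi')
    have fact : ∀ {w : Fin 2 → ℂ}, w 0 ≠ 0 → ‖w 0‖ = ‖w 1‖ →
        ∃ α : ℂ, ‖α‖ = 1 ∧ w 1 = w 0 * α := by
      intro w h0 h01
      refine ⟨w 1 / w 0, ?_, by field_simp⟩
      rw [norm_div, ← h01, div_self (norm_ne_zero_iff.2 h0)]
    obtain ⟨α, hα, hxα⟩ := fact hx0 hx
    obtain ⟨β, hβ, hyβ⟩ := fact hy0 hy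
    obtain ⟨γ, hγ, hzγ⟩ := fact hz0 hz
    have hval : (conj α * conj β).re * (conj γ).re +
        (conj α * conj (conj β)).im * (conj γ).im = -√2 := by
      rw [sum_antiSign_prodVec, hm b, hxα, hyβ, hzγ, sqrt_eight] at hcross
      have e : ∀ w δ : ℂ, w * conj (w * δ) = ((‖w‖ ^ 2 : ℝ) : ℂ) * conj δ := by
        intro w δ
        rw [map_mul, ← mul_assoc, Complex.mul_conj, Complex.normSq_eq_norm_sq]
      rw [e, e, e] at hcross
      have hpos : 0 < ‖x 0‖ ^ 2 * ‖y 0‖ ^ 2 * ‖z 0‖ ^ 2 := by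
        have := norm_pos_iff.2 hx0
        have := norm_pos_iff.2 hy0
        have := norm_pos_iff.2 hz0
        positivity
      have e1 : ∀ (s t : ℝ) (δ ε : ℂ),
          (s : ℂ) * δ * ((t : ℂ) * ε) = ((s * t : ℝ) : ℂ) * (δ * ε) := by
        intro s t δ ε
        push_cast
        ring
      rw [map_mul conj ((‖y 0‖ ^ 2 : ℝ) : ℂ), Complex.conj_ofReal, e1, e1,
        Complex.re_ofReal_mul, Complex.re_ofReal_mul, Complex.im_ofReal_mul,
        Complex.im_ofReal_mul] at hcross
      simp only [norm_mul, Complex.norm_real, norm_pow, norm_norm, RCLike.norm_conj, hα, hβ, hγ,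
        mul_one] at hcross
      refine mul_left_cancel₀ hpos.ne' ?_
      linear_combination (1 / 4) * hcross
    obtain ⟨j, rfl, rfl, rfl⟩ := exists_phase_eq hα hβ hγ hval
    refine ⟨j, x 0 * y 0 * z 0, funext ?_⟩
    rintro ⟨i₁, i₂, i₃⟩
    fin_cases i₁ <;> fin_cases i₂ <;> fin_cases i₃ <;> simp [prodVec, hxα, hyβ, hzγ] <;> ring

/-! ### Pure states and vertices -/

theorem pureState_smul {c : ℂ} (hc : c ≠ 0) (v : Idx → ℂ) : pureState (c • v) = pureState v := by
  have hc' : star c ≠ 0 := star_ne_zero.2 hc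
  ext i j
  simp only [pureState, Matrix.smul_apply, Matrix.vecMulVec_apply, Pi.smul_apply, Pi.star_apply,
    star_smul, smul_dotProduct, dotProduct_smul, smul_eq_mul, mul_inv]
  field_simp

theorem pureState_of_unit {v : Idx → ℂ} (hv : star v ⬝ᵥ v = 1) :
    pureState v = Matrix.vecMulVec v (star v) := by
  rw [pureState, hv, inv_one, one_smul]

theorem star_dotProduct_self (v : Idx → ℂ) : star v ⬝ᵥ v = ((∑ i, ‖v i‖ ^ 2 : ℝ) : ℂ) := by
  simp only [dotProduct, Pi.star_apply, RCLike.star_def]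
  push_cast
  refine Finset.sum_congr rfl fun i _ => ?_
  rw [mul_comm, Complex.mul_conj, Complex.normSq_eq_norm_sq]
  push_cast
  rfl

theorem sum_norm_sq_pos {v : Idx → ℂ} (hv : v ≠ 0) : 0 < ∑ i, ‖v i‖ ^ 2 := by
  obtain ⟨i, hi⟩ := Function.ne_iff.1 hv
  exact Finset.sum_pos' (fun _ _ => by positivity)
    ⟨i, Finset.mem_univ i, by have := norm_pos_iff.2 hi; positivity⟩

theorem prodVec_smul (c : ℂ) (x y z : Fin 2 → ℂ) :
    prodVec (c • x) y z = c • prodVec x y z := by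
  funext i
  simp [prodVec, mul_assoc]

theorem pureState_prodVec_mem {x y z : Fin 2 → ℂ} (h : prodVec x y z ≠ 0) :
    pureState (prodVec x y z) ∈ pureProductStates := by
  have hn := sum_norm_sq_pos h
  set n := ∑ i, ‖prodVec x y z i‖ ^ 2 with hn'
  have hs : 0 < √n := Real.sqrt_pos.2 hn
  have hc : ((√n)⁻¹ : ℂ) ≠ 0 := by exact_mod_cast (inv_pos.2 hs).ne'
  have hunit : star (prodVec (((√n)⁻¹ : ℂ) • x) y z) ⬝ᵥ prodVec (((√n)⁻¹ : ℂ) • x) y z = 1 := by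
    rw [prodVec_smul, star_smul, smul_dotProduct, dotProduct_smul, star_dotProduct_self, ← hn',
      RCLike.star_def, map_inv₀, Complex.conj_ofReal, smul_eq_mul, smul_eq_mul,
      ← Complex.ofReal_inv, ← Complex.ofReal_mul, ← Complex.ofReal_mul, ← Complex.ofReal_one]
    congr 1
    rw [← mul_assoc, ← mul_inv, Real.mul_self_sqrt hn.le, inv_mul_cancel₀ hn.ne']
  exact ⟨_, _, _, hunit, by rw [← pureState_of_unit hunit, prodVec_smul, pureState_smul hc]⟩

theorem single_eq_prodVec (i : Idx) :
    (Pi.single i 1 : Idx → ℂ) =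
      prodVec (Pi.single i.1 1) (Pi.single i.2.1 1) (Pi.single i.2.2 1) := by
  funext k
  obtain ⟨i₁, i₂, i₃⟩ := i
  obtain ⟨k₁, k₂, k₃⟩ := k
  simp only [prodVec, Pi.single_apply, Prod.mk.injEq]
  split_ifs <;> simp_all

theorem single_ne_zero (i : Idx) : (Pi.single i 1 : Idx → ℂ) ≠ 0 := by
  simp

theorem pureState_single_mem (i : Idx) : pureState (Pi.single i 1) ∈ pureProductStates := by
  have h := single_ne_zero i
  rw [single_eq_prodVec] at h ⊢
  exact pureState_prodVec_mem h

/-- Local rescaling of the two entries of a qubit vector by `√p` and `1 / √p`. -/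
noncomputable def rescale (p : ℝ) (x : Fin 2 → ℂ) : Fin 2 → ℂ :=
  fun i => (√(if i = 0 then p else p⁻¹) : ℂ) * x i

theorem prodVec_rescale {p q r : ℝ} (hp : 0 < p) (hq : 0 < q) (x y z : Fin 2 → ℂ)
    (i : Idx) : prodVec (rescale p x) (rescale q y) (rescale r z) i =
      √(weight p q r i) * prodVec x y z i := by
  have h1 : 0 ≤ (if i.1 = 0 then p else p⁻¹) := by split_ifs <;> positivity
  have h2 : 0 ≤ (if i.2.1 = 0 then q else q⁻¹) := by split_ifs <;> positivity
  simp only [prodVec, rescale]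
  rw [weight, Real.sqrt_mul (mul_nonneg h1 h2), Real.sqrt_mul h1]
  push_cast
  ring

theorem star_rescale (p : ℝ) (x : Fin 2 → ℂ) : star (rescale p x) = rescale p (star x) := by
  funext i
  simp [rescale]

theorem exists_rescale {p : ℝ} (hp : 0 < p) (x : Fin 2 → ℂ) : ∃ x', x = rescale p x' := by
  refine ⟨fun i => (√(if i = 0 then p else p⁻¹) : ℂ)⁻¹ * x i, funext fun i => ?_⟩
  have h : (√(if i = 0 then p else p⁻¹) : ℂ) ≠ 0 := by
    have : 0 < √(if i = 0 then p else p⁻¹) := Real.sqrt_pos.2 (by split_ifs <;> positivity)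
    exact_mod_cast this.ne'
  rw [rescale, mul_inv_cancel_left₀ h]

theorem eta_eq_prodVec {p q r : ℝ} (hp : 0 < p) (hq : 0 < q) (hr : 0 < r) (j : Fin 8) :
    eta p q r j = prodVec (rescale p ![1, phase j 0]) (rescale q ![1, phase j 1])
      (rescale r ![1, phase j 2]) := by
  funext i
  rw [eta_apply hp hq hr, prodVec_rescale hp hq]

theorem norm_eta_sq {p q r : ℝ} (hp : 0 < p) (hq : 0 < q) (hr : 0 < r) (j : Fin 8) (i : Idx) :
    ‖eta p q r j i‖ ^ 2 = weight p q r i := by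
  have hn : ‖prodVec ![1, phase j 0] ![1, phase j 1] ![1, phase j 2] i‖ = 1 := by
    obtain ⟨i₁, i₂, i₃⟩ := i
    fin_cases i₁ <;> fin_cases i₂ <;> fin_cases i₃ <;> simp [prodVec, norm_phase]
  rw [eta_apply hp hq hr, norm_mul, hn, mul_one, Complex.norm_real, Real.norm_eq_abs, sq_abs,
    Real.sq_sqrt (weight_pos hp hq hr i).le]

theorem eta_ne_zero {p q r : ℝ} (hp : 0 < p) (hq : 0 < q) (hr : 0 < r) (j : Fin 8) :
    eta p q r j ≠ 0 := by
  intro h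
  have h1 := norm_eta_sq hp hq hr j (0, 0, 0)
  rw [h] at h1
  simpa using h1.trans_ne (weight_pos hp hq hr _).ne'

theorem pureState_eta_mem {p q r : ℝ} (hp : 0 < p) (hq : 0 < q) (hr : 0 < r) (j : Fin 8) :
    pureState (eta p q r j) ∈ pureProductStates := by
  have h := eta_ne_zero hp hq hr j
  rw [eta_eq_prodVec hp hq hr] at h ⊢
  exact pureState_prodVec_mem h

/-- The real linear functional `ρ ↦ ⟨V, ρ⟩`. -/
noncomputable def pairingRe (V : Mat) : Mat →ₗ[ℝ] ℝ where
  toFun ρ := (pairing V ρ).re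
  map_add' ρ σ := by simp [pairing, add_mul]
  map_smul' c ρ := by simp [pairing]

/-- The imaginary part of `ρ ↦ ⟨V, ρ⟩`. -/
noncomputable def pairingIm (V : Mat) : Mat →ₗ[ℝ] ℝ where
  toFun ρ := (pairing V ρ).im
  map_add' ρ σ := by simp [pairing, add_mul]
  map_smul' c ρ := by simp [pairing]

/-! ### The dual face as the convex hull of ten vertices -/

theorem witnessForm_prodVec_nonneg {p q r : ℝ} (hp : 0 < p) (hq : 0 < q) (hr : 0 < r) (b : Idx)
    (x y z : Fin 2 → ℂ) : 0 ≤ witnessForm p q r b (prodVec x y z) := by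
  obtain ⟨x, rfl⟩ := exists_rescale hp x
  obtain ⟨y, rfl⟩ := exists_rescale hq y
  obtain ⟨z, rfl⟩ := exists_rescale hr z
  rw [funext (prodVec_rescale hp hq x y z), witnessForm_sqrt_weight_mul hp hq hr]
  exact witnessForm_one_prodVec_nonneg x y z b

theorem pairingRe_nonneg {p q r : ℝ} (hp : 0 < p) (hq : 0 < q) (hr : 0 < r) (b : Idx) :
    ∀ ρ ∈ pureProductStates, 0 ≤ pairingRe (xWitness p q r b) ρ := by
  rintro _ ⟨x, y, z, -, rfl⟩
  change 0 ≤ (pairing _ _).re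
  rw [pairing_xWitness, Complex.ofReal_re]
  exact witnessForm_prodVec_nonneg hp hq hr b x y z

/-- The pairing is real on pure product states, hence on separable states, so the real functional
`pairingRe` suffices to describe the dual face. -/
theorem pairing_eq_zero_iff {p q r : ℝ} {b : Idx} {ρ : Mat} (hρ : ρ ∈ separableStates) :
    pairing (xWitness p q r b) ρ = 0 ↔ pairingRe (xWitness p q r b) ρ = 0 := by
  have him : separableStates ⊆ {ρ | pairingIm (xWitness p q r b) ρ = 0} := by
    refine convexHull_min ?_ (convex_hyperplane (pairingIm _).isLinear 0)
    rintro _ ⟨x, y, z, -, rfl⟩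
    change (pairing _ _).im = 0
    rw [pairing_xWitness, Complex.ofReal_im]
  exact ⟨fun h => congrArg Complex.re h, fun h => Complex.ext h (him hρ)⟩

theorem pairing_pureState (p q r : ℝ) (b : Idx) (v : Idx → ℂ) :
    pairing (xWitness p q r b) (pureState v) =
      (star v ⬝ᵥ v)⁻¹ * (witnessForm p q r b v : ℝ) := by
  rw [← pairing_xWitness, pureState, pairing, pairing, Matrix.smul_mul, Matrix.trace_smul,
    smul_eq_mul]

/-- The ten vertices of the dual face. -/
noncomputable def vertex (p q r : ℝ) (b : Idx) : Fin 10 → Mat :=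
  Fin.append (m := 2) (n := 8) ![pureState (Pi.single b 1), pureState (Pi.single (opp b) 1)]
    (fun j => pureState (eta p q r j))

theorem range_vertex (p q r : ℝ) (b : Idx) : Set.range (vertex p q r b) =
    {pureState (Pi.single b 1), pureState (Pi.single (opp b) 1)} ∪
      Set.range (fun j : Fin 8 => pureState (eta p q r j)) := by
  ext ρ
  constructor
  · rintro ⟨i, rfl⟩
    refine Fin.addCases (m := 2) (n := 8) (fun i => ?_) (fun j => ?_) i
    · left
      rw [vertex, Fin.append_left]
      fin_cases i <;> simp
    · right
      rw [vertex, Fin.append_right]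
      exact ⟨j, rfl⟩
  · rintro ((rfl | rfl) | ⟨j, rfl⟩)
    · exact ⟨Fin.castAdd 8 (0 : Fin 2), by rw [vertex, Fin.append_left]; rfl⟩
    · exact ⟨Fin.castAdd 8 (1 : Fin 2), by rw [vertex, Fin.append_left]; rfl⟩
    · exact ⟨Fin.natAdd 2 j, by rw [vertex, Fin.append_right]⟩

theorem mem_range_vertex_iff {p q r : ℝ} (hp : 0 < p) (hq : 0 < q) (hr : 0 < r) (b : Idx)
    (ρ : Mat) : ρ ∈ Set.range (vertex p q r b) ↔
      ρ ∈ pureProductStates ∧ pairingRe (xWitness p q r b) ρ = 0 := by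
  rw [range_vertex]
  constructor
  · rintro ((rfl | rfl) | ⟨j, rfl⟩)
    · refine ⟨pureState_single_mem b, ?_⟩
      change (pairing _ _).re = 0
      rw [pairing_pureState, witnessForm_single p q r (.inl rfl)]
      simp
    · refine ⟨pureState_single_mem (opp b), ?_⟩
      change (pairing _ _).re = 0
      rw [pairing_pureState, witnessForm_single p q r (.inr rfl)]
      simp
    · refine ⟨pureState_eta_mem hp hq hr j, ?_⟩
      change (pairing _ _).re = 0
      rw [pairing_pureState, witnessForm_eta hp hq hr]
      simp
  · rintro ⟨⟨x, y, z, hunit, rfl⟩, h0⟩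
    change (pairing _ _).re = 0 at h0
    rw [pairing_xWitness, Complex.ofReal_re] at h0
    rw [← pureState_of_unit hunit]
    have hne : prodVec x y z ≠ 0 := by
      intro h
      simp [h] at hunit
    clear hunit
    have scale : ∀ {c : ℂ} {w : Idx → ℂ}, prodVec x y z = c • w →
        pureState (prodVec x y z) = pureState w := by
      intro c w h
      have hc : c ≠ 0 := by
        rintro rfl
        exact hne (by rw [h, zero_smul])
      rw [h, pureState_smul hc]
    obtain ⟨x, rfl⟩ := exists_rescale hp x
    obtain ⟨y, rfl⟩ := exists_rescale hq y
    obtain ⟨z, rfl⟩ := exists_rescale hr z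
    rw [funext (prodVec_rescale hp hq x y z), witnessForm_sqrt_weight_mul hp hq hr] at h0
    have hsingle : ∀ {c : ℂ} {k : Idx}, prodVec x y z = c • Pi.single k 1 →
        prodVec (rescale p x) (rescale q y) (rescale r z) =
          (√(weight p q r k) * c : ℂ) • Pi.single k 1 := by
      intro c k h
      funext i
      rw [prodVec_rescale hp hq, h]
      by_cases hi : i = k
      · subst hi; simp
      · simp [hi]
    rcases prodVec_of_witnessForm_one_eq_zero h0 with ⟨c, h⟩ | ⟨c, h⟩ | ⟨j, c, h⟩
    · exact .inl (.inl (scale (hsingle h)))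
    · exact .inl (.inr (scale (hsingle h)))
    · refine .inr ⟨j, (scale (c := c) ?_).symm⟩
      funext i
      rw [prodVec_rescale hp hq, h, Pi.smul_apply, Pi.smul_apply, eta_apply hp hq hr, smul_eq_mul,
        smul_eq_mul]
      ring

theorem dualFace_xWitness {p q r : ℝ} (hp : 0 < p) (hq : 0 < q) (hr : 0 < r) (b : Idx) :
    dualFace (xWitness p q r b) = convexHull ℝ (Set.range (vertex p q r b)) := by
  rw [← convexHull_sep_eq_zero (pairingRe_nonneg hp hq hr b) (mem_range_vertex_iff hp hq hr b)]
  ext ρ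
  exact and_congr_right fun hρ => pairing_eq_zero_iff hρ

/-! ### Linear independence of the vertices -/

/-- Real and imaginary parts give nine real linear equations in eight unknowns, of full rank. -/
theorem eq_zero_of_phase_sums {c : Fin 8 → ℝ} (h1 : ∑ j, c j = 0)
    (hα : ∑ j, (c j : ℂ) * phase j 0 = 0) (hβ : ∑ j, (c j : ℂ) * phase j 1 = 0)
    (hγ : ∑ j, (c j : ℂ) * phase j 2 = 0)
    (hαβγ : ∑ j, (c j : ℂ) * (phase j 0 * phase j 1 * phase j 2) = 0) : c = 0 := by
  have hh := sqrt_two_div_two_sq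
  have hpos : √2 / 2 ≠ 0 := by positivity
  have hcube : ∀ s₁ t₁ s₂ t₂ s₃ t₃ : ℝ, diagPhase s₁ t₁ * diagPhase s₂ t₂ * diagPhase s₃ t₃ =
      diagPhase (((s₁ * s₂ - t₁ * t₂) * s₃ - (s₁ * t₂ + t₁ * s₂) * t₃) / 2)
        (((s₁ * s₂ - t₁ * t₂) * t₃ + (s₁ * t₂ + t₁ * s₂) * s₃) / 2) := by
    intro s₁ t₁ s₂ t₂ s₃ t₃
    apply Complex.ext
    · simp [diagPhase]
      linear_combination (√2 / 2) *
        ((s₁ * s₂ - t₁ * t₂) * s₃ - (s₁ * t₂ + t₁ * s₂) * t₃) * hh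
    · simp [diagPhase]
      linear_combination (√2 / 2) *
        ((s₁ * s₂ - t₁ * t₂) * t₃ + (s₁ * t₂ + t₁ * s₂) * s₃) * hh
  have hre : ∀ a s t : ℝ, ((a : ℂ) * diagPhase s t).re = a * s * (√2 / 2) := by
    intro a s t
    simp [diagPhase, mul_assoc]
  have him : ∀ a s t : ℝ, ((a : ℂ) * diagPhase s t).im = a * t * (√2 / 2) := by
    intro a s t
    simp [diagPhase, mul_assoc]
  rw [phase_eq] at hα hβ hγ hαβγ
  simp only [Fin.sum_univ_eight] at h1 hα hβ hγ hαβγ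
  change (c 0 : ℂ) * diagPhase (-1) 1 + (c 1 : ℂ) * diagPhase (-1) 1 +
      (c 2 : ℂ) * diagPhase 1 (-1) + (c 3 : ℂ) * diagPhase 1 (-1) +
      (c 4 : ℂ) * diagPhase (-1) (-1) + (c 5 : ℂ) * diagPhase (-1) (-1) +
      (c 6 : ℂ) * diagPhase 1 1 + (c 7 : ℂ) * diagPhase 1 1 = 0 at hα
  change (c 0 : ℂ) * diagPhase 1 1 + (c 1 : ℂ) * diagPhase (-1) (-1) +
      (c 2 : ℂ) * diagPhase 1 1 + (c 3 : ℂ) * diagPhase (-1) (-1) +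
      (c 4 : ℂ) * diagPhase 1 (-1) + (c 5 : ℂ) * diagPhase (-1) 1 +
      (c 6 : ℂ) * diagPhase 1 (-1) + (c 7 : ℂ) * diagPhase (-1) 1 = 0 at hβ
  change (c 0 : ℂ) * diagPhase 1 (-1) + (c 1 : ℂ) * diagPhase (-1) 1 +
      (c 2 : ℂ) * diagPhase (-1) 1 + (c 3 : ℂ) * diagPhase 1 (-1) + (c 4 : ℂ) * diagPhase 1 1 +
      (c 5 : ℂ) * diagPhase (-1) (-1) + (c 6 : ℂ) * diagPhase (-1) (-1) +
      (c 7 : ℂ) * diagPhase 1 1 = 0 at hγ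
  change (c 0 : ℂ) * (diagPhase (-1) 1 * diagPhase 1 1 * diagPhase 1 (-1)) +
      (c 1 : ℂ) * (diagPhase (-1) 1 * diagPhase (-1) (-1) * diagPhase (-1) 1) +
      (c 2 : ℂ) * (diagPhase 1 (-1) * diagPhase 1 1 * diagPhase (-1) 1) +
      (c 3 : ℂ) * (diagPhase 1 (-1) * diagPhase (-1) (-1) * diagPhase 1 (-1)) +
      (c 4 : ℂ) * (diagPhase (-1) (-1) * diagPhase 1 (-1) * diagPhase 1 1) +
      (c 5 : ℂ) * (diagPhase (-1) (-1) * diagPhase (-1) 1 * diagPhase (-1) (-1)) +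
      (c 6 : ℂ) * (diagPhase 1 1 * diagPhase 1 (-1) * diagPhase (-1) (-1)) +
      (c 7 : ℂ) * (diagPhase 1 1 * diagPhase (-1) 1 * diagPhase 1 1) = 0 at hαβγ
  simp only [hcube] at hαβγ
  have hαr := congrArg Complex.re hα
  have hαi := congrArg Complex.im hα
  have hβr := congrArg Complex.re hβ
  have hβi := congrArg Complex.im hβ
  have hγr := congrArg Complex.re hγ
  have hγi := congrArg Complex.im hγ
  have hαβγr := congrArg Complex.re hαβγ
  have hαβγi := congrArg Complex.im hαβγ
  simp only [Complex.add_re, hre, Complex.zero_re] at hαr hβr hγr hαβγr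
  simp only [Complex.add_im, him, Complex.zero_im] at hαi hβi hγi hαβγi
  -- With this factor all equations are linear in the products `c j * (√2 / 2)`.
  have h1' : (c 0 + c 1 + c 2 + c 3 + c 4 + c 5 + c 6 + c 7) * (√2 / 2) = 0 := by
    rw [h1, zero_mul]
  clear hcube hre him hα hβ hγ hαβγ h1 hh
  funext j
  refine (mul_eq_zero.1 (?_ : c j * (√2 / 2) = 0)).resolve_right hpos
  fin_cases j <;> simp only [Fin.reduceFinMk, Fin.zero_eta, Fin.mk_one, Fin.isValue] <;> linarith

theorem pureState_eta_apply {p q r : ℝ} (hp : 0 < p) (hq : 0 < q) (hr : 0 < r) (j : Fin 8)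
    (i k : Idx) : pureState (eta p q r j) i k =
      ((∑ i, weight p q r i : ℝ) : ℂ)⁻¹ * (√(weight p q r i) * √(weight p q r k)) *
        (prodVec ![1, phase j 0] ![1, phase j 1] ![1, phase j 2] i *
          conj (prodVec ![1, phase j 0] ![1, phase j 1] ![1, phase j 2] k)) := by
  rw [pureState, star_dotProduct_self, Finset.sum_congr rfl fun i _ => norm_eta_sq hp hq hr j i,
    Matrix.smul_apply, Matrix.vecMulVec_apply, Pi.star_apply, eta_apply hp hq hr,
    eta_apply hp hq hr, RCLike.star_def, map_mul, Complex.conj_ofReal, smul_eq_mul]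
  ring

theorem pureState_single_apply (b i k : Idx) :
    pureState (Pi.single b 1) i k = if i = b ∧ k = b then 1 else 0 := by
  rw [pureState]
  by_cases hi : i = b <;> by_cases hk : k = b <;>
    simp [Matrix.vecMulVec_apply, hi, hk]

theorem sum_vertex (p q r : ℝ) (b : Idx) (g : Fin 10 → ℝ) :
    ∑ i, g i • vertex p q r b i =
      g 0 • pureState (Pi.single b 1) + g 1 • pureState (Pi.single (opp b) 1) +
        ∑ j : Fin 8, g (Fin.natAdd 2 j) • pureState (eta p q r j) := by
  refine (Fin.sum_univ_add (a := 2) (b := 8) fun i => g i • vertex p q r b i).trans ?_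
  simp only [vertex, Fin.append_left, Fin.append_right, Fin.sum_univ_two]
  rfl

theorem exists_ne_and_ne_opp (b : Idx) : ∃ k, k ≠ b ∧ k ≠ opp b := by
  revert b; decide

theorem linearIndependent_vertex {p q r : ℝ} (hp : 0 < p) (hq : 0 < q) (hr : 0 < r) (b : Idx) :
    LinearIndependent ℝ (vertex p q r b) := by
  rw [Fintype.linearIndependent_iff]
  intro g hg
  rw [sum_vertex] at hg
  have hw := fun i => weight_pos hp hq hr i
  have hs : ∀ i, (√(weight p q r i) : ℂ) ≠ 0 := fun i => by
    exact_mod_cast (Real.sqrt_pos.2 (hw i)).ne'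
  have hn : ((∑ i, weight p q r i : ℝ) : ℂ) ≠ 0 := by
    exact_mod_cast (Finset.sum_pos (fun i _ => hw i) Finset.univ_nonempty).ne'
  -- The two basis states live on the diagonal at `b` and `opp b`; every other matrix entry sees
  -- only the `eta` states.
  have hentry : ∀ i k, (i = k → i ≠ b ∧ i ≠ opp b) → ∑ j : Fin 8, (g (Fin.natAdd 2 j) : ℂ) *
      (prodVec ![1, phase j 0] ![1, phase j 1] ![1, phase j 2] i *
        conj (prodVec ![1, phase j 0] ![1, phase j 1] ![1, phase j 2] k)) = 0 := by
    intro i k hik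
    have h := congrFun (congrFun hg i) k
    have hb : ¬ (i = b ∧ k = b) := fun h => (hik (h.1.trans h.2.symm)).1 h.1
    have hb' : ¬ (i = opp b ∧ k = opp b) := fun h => (hik (h.1.trans h.2.symm)).2 h.1
    simp only [Matrix.add_apply, Matrix.smul_apply, pureState_single_apply, if_neg hb, if_neg hb',
      smul_zero, zero_add, Matrix.sum_apply, pureState_eta_apply hp hq hr, Matrix.zero_apply,
      Complex.real_smul] at h
    refine (mul_eq_zero.1 (Eq.trans ?_ h)).resolve_left
      (mul_ne_zero (inv_ne_zero hn) (mul_ne_zero (hs i) (hs k)))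
    rw [Finset.mul_sum]
    exact Finset.sum_congr rfl fun j _ => by ring
  have hzero : (fun j : Fin 8 => g (Fin.natAdd 2 j)) = 0 := by
    apply eq_zero_of_phase_sums
    · obtain ⟨k, hk⟩ := exists_ne_and_ne_opp b
      have h := hentry k k fun _ => hk
      have hone : ∀ j, prodVec ![1, phase j 0] ![1, phase j 1] ![1, phase j 2] k *
          conj (prodVec ![1, phase j 0] ![1, phase j 1] ![1, phase j 2] k) = 1 := by
        intro j
        rw [Complex.mul_conj, Complex.normSq_eq_norm_sq]
        obtain ⟨k₁, k₂, k₃⟩ := k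
        fin_cases k₁ <;> fin_cases k₂ <;> fin_cases k₃ <;> simp [prodVec, norm_phase]
      simp only [hone, mul_one] at h
      exact_mod_cast h
    · simpa [prodVec] using hentry (1, 0, 0) (0, 0, 0) (by simp)
    · simpa [prodVec] using hentry (0, 1, 0) (0, 0, 0) (by simp)
    · simpa [prodVec] using hentry (0, 0, 1) (0, 0, 0) (by simp)
    · simpa [prodVec] using hentry (1, 1, 1) (0, 0, 0) (by simp)
  have h8 : ∀ j : Fin 8, g (Fin.natAdd 2 j) = 0 := congrFun hzero
  simp only [h8, zero_smul, Finset.sum_const_zero, add_zero] at hg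
  have h0 : g 0 = 0 := by
    simpa [pureState_single_apply, (opp_ne b).symm] using congrFun (congrFun hg b) b
  have h1 : g 1 = 0 := by
    simpa [pureState_single_apply, opp_ne b] using congrFun (congrFun hg (opp b)) (opp b)
  intro i
  refine Fin.addCases (m := 2) (n := 8) (fun i => ?_) h8 i
  fin_cases i
  · exact h0
  · exact h1

/-! ### Partial transposes of interior points -/

theorem ne_conj_of_pow_four {z : ℂ} (hz : z ^ 4 = -1) : z - conj z ≠ 0 := by
  intro h
  obtain ⟨x, rfl⟩ := Complex.conj_eq_iff_real.1 (sub_eq_zero.1 h).symm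
  have : x ^ 4 = -1 := by exact_mod_cast hz
  nlinarith [sq_nonneg (x ^ 2)]

/-- The common shape of the phase triples and of their partial conjugates. -/
noncomputable def phasePattern (A B C : ℂ) : Fin 8 → Fin 3 → ℂ :=
  ![![A, B, C], ![A, -B, -C], ![-A, B, -C], ![-A, -B, C],
    ![conj A, conj B, conj C], ![conj A, -conj B, -conj C], ![-conj A, conj B, -conj C],
    ![-conj A, -conj B, conj C]]

/-- The signs in `phasePattern`. -/
noncomputable def phaseSign : Fin 8 → Fin 3 → ℂ :=
  ![![1, 1, 1], ![1, -1, -1], ![-1, 1, -1], ![-1, -1, 1],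
    ![1, 1, 1], ![1, -1, -1], ![-1, 1, -1], ![-1, -1, 1]]

theorem phasePattern_eq (A B C : ℂ) (j : Fin 8) (k : Fin 3) : phasePattern A B C j k =
    phaseSign j k * if j < 4 then ![A, B, C] k else conj (![A, B, C] k) := by
  fin_cases j <;> fin_cases k <;> simp [phasePattern, phaseSign]

theorem conj_phaseSign (j : Fin 8) (k : Fin 3) : conj (phaseSign j k) = phaseSign j k := by
  fin_cases j <;> fin_cases k <;> simp [phaseSign]

theorem phase_eq_phasePattern : phase = phasePattern (ω ^ 3) ω (ω ^ 7) := by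
  funext j k
  fin_cases j <;> fin_cases k <;> simp [phasePattern, phase]

/-- Averaging over the four sign patterns splits the equations into four 2×2 systems, one per
opposite pair of coordinates. Each determinant has, up to sign, the form `z - conj z` with `z⁴ =
-1`, which is nonzero because `z` is not real. -/
theorem eq_zero_of_phasePattern {A B C : ℂ} (hA : A ^ 4 = -1) (hB : B ^ 4 = -1) (hC : C ^ 4 = -1)
    {g : Idx → ℂ} (h : ∀ j, ∑ i, prodVec ![1, phasePattern A B C j 0]
      ![1, phasePattern A B C j 1] ![1, phasePattern A B C j 2] i * g i = 0) : g = 0 := by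
  have ne : ∀ {z : ℂ}, z ^ 4 = -1 → z ≠ 0 := by
    rintro z hz rfl
    norm_num at hz
  have hconj : ∀ {z : ℂ}, z ^ 4 = -1 → conj z ^ 4 = -1 := by
    intro z hz
    rw [← map_pow, hz, map_neg, map_one]
  have hA' := ne hA
  have hB' := ne hB
  have hC' := ne hC
  have split : ∀ A B C : ℂ,
      ∑ i, prodVec ![1, A] ![1, B] ![1, C] i * g i = 0 →
      ∑ i, prodVec ![1, A] ![1, -B] ![1, -C] i * g i = 0 →
      ∑ i, prodVec ![1, -A] ![1, B] ![1, -C] i * g i = 0 →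
      ∑ i, prodVec ![1, -A] ![1, -B] ![1, C] i * g i = 0 →
      (g (0, 0, 0) + A * B * C * g (1, 1, 1) = 0 ∧ A * g (1, 0, 0) + B * C * g (0, 1, 1) = 0) ∧
      (B * g (0, 1, 0) + A * C * g (1, 0, 1) = 0 ∧
        C * g (0, 0, 1) + A * B * g (1, 1, 0) = 0) := by
    intro A B C h0 h1 h2 h3
    simp [sum_idx, prodVec] at h0 h1 h2 h3
    refine ⟨⟨?_, ?_⟩, ?_, ?_⟩
    · linear_combination (h0 + h1 + h2 + h3) / 4
    · linear_combination (h0 + h1 - h2 - h3) / 4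
    · linear_combination (h0 - h1 + h2 - h3) / 4
    · linear_combination (h0 - h1 - h2 + h3) / 4
  obtain ⟨⟨e1, e2⟩, e3, e4⟩ := split A B C (h 0) (h 1) (h 2) (h 3)
  obtain ⟨⟨f1, f2⟩, f3, f4⟩ := split (conj A) (conj B) (conj C) (h 4) (h 5) (h 6) (h 7)
  have solve : ∀ {P Q R x y : ℂ}, P ^ 4 = -1 → Q ^ 4 = -1 → R ^ 4 = -1 →
      P * x + Q * R * y = 0 → conj P * x + conj Q * conj R * y = 0 → x = 0 ∧ y = 0 := by
    intro P Q R x y hP hQ hR h1 h2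
    have hZ : (P * (conj Q * conj R)) ^ 4 = -1 := by
      rw [mul_pow, mul_pow, hP, hconj hQ, hconj hR]
      norm_num
    have hx : x = 0 := by
      refine (mul_eq_zero.1 ?_).resolve_left (ne_conj_of_pow_four hZ)
      simp only [map_mul, Complex.conj_conj]
      linear_combination conj Q * conj R * h1 - Q * R * h2
    refine ⟨hx, ?_⟩
    rw [hx, mul_zero, zero_add] at h1
    exact (mul_eq_zero.1 h1).resolve_left (mul_ne_zero (ne hQ) (ne hR))
  obtain ⟨g100, g011⟩ := solve hA hB hC e2 f2
  obtain ⟨g010, g101⟩ := solve hB hA hC e3 f3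
  obtain ⟨g001, g110⟩ := solve hC hA hB e4 f4
  have hZ : (A * B * C) ^ 4 = -1 := by
    rw [mul_pow, mul_pow, hA, hB, hC]
    norm_num
  have g111 : g (1, 1, 1) = 0 := by
    refine (mul_eq_zero.1 ?_).resolve_left (ne_conj_of_pow_four hZ)
    simp only [map_mul]
    linear_combination e1 - f1
  have g000 : g (0, 0, 0) = 0 := by
    rw [g111, mul_zero, add_zero] at e1
    exact e1
  funext ⟨i₁, i₂, i₃⟩
  fin_cases i₁ <;> fin_cases i₂ <;> fin_cases i₃ <;> assumption

/-- Entrywise conjugation of the vector of party `k`, provided that `k` belongs to `S`. -/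
noncomputable def conjOn (S : Finset (Fin 3)) (k : Fin 3) (x : Fin 2 → ℂ) : Fin 2 → ℂ :=
  if k ∈ S then star x else x

theorem partialTranspose_vecMulVec (S : Finset (Fin 3)) (x y z : Fin 2 → ℂ) :
    partialTranspose S (Matrix.vecMulVec (prodVec x y z) (star (prodVec x y z))) =
      Matrix.vecMulVec (prodVec (conjOn S 0 x) (conjOn S 1 y) (conjOn S 2 z))
        (star (prodVec (conjOn S 0 x) (conjOn S 1 y) (conjOn S 2 z))) := by
  ext i j
  simp only [partialTranspose, Matrix.of_apply, Matrix.vecMulVec_apply, Pi.star_apply, prodVec,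
    conjOn, star_mul']
  split_ifs <;> simp <;> ring

theorem partialTranspose_sum {ι : Type*} (S : Finset (Fin 3)) (T : Finset ι) (c : ι → ℝ)
    (M : ι → Mat) :
    partialTranspose S (∑ i ∈ T, c i • M i) = ∑ i ∈ T, c i • partialTranspose S (M i) := by
  ext i j
  simp [partialTranspose, Matrix.sum_apply]

theorem partialTranspose_smul (S : Finset (Fin 3)) (c : ℂ) (M : Mat) :
    partialTranspose S (c • M) = c • partialTranspose S M := rfl

theorem posSemidef_partialTranspose (S : Finset (Fin 3)) {ρ : Mat} (hρ : ρ ∈ pureProductStates) :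
    (partialTranspose S ρ).PosSemidef := by
  obtain ⟨x, y, z, -, rfl⟩ := hρ
  rw [partialTranspose_vecMulVec]
  exact Matrix.posSemidef_vecMulVec_self_star _

theorem conjOn_rescale (S : Finset (Fin 3)) (k : Fin 3) (p : ℝ) (x : Fin 2 → ℂ) :
    conjOn S k (rescale p x) = rescale p (conjOn S k x) := by
  unfold conjOn
  split_ifs
  · exact star_rescale p x
  · rfl

/-- The partially conjugated vectors `eta p q r j` span. -/
theorem eq_zero_of_partialTranspose_eta {p q r : ℝ} (hp : 0 < p) (hq : 0 < q) (hr : 0 < r)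
    (S : Finset (Fin 3)) {v : Idx → ℂ}
    (h : ∀ j, (partialTranspose S (pureState (eta p q r j))).mulVec v = 0) : v = 0 := by
  have hω : ω ^ 4 = -1 := by
    rw [show ω ^ 4 = (ω ^ 2) ^ 2 by ring, ω_sq, Complex.I_sq]
  let a : Fin 3 → ℂ := ![ω ^ 3, ω, ω ^ 7]
  -- The bra is the conjugate of the partially conjugated vector, so the parties outside `S` are the
  -- ones conjugated here.
  let d : Fin 3 → ℂ := fun k => if k ∈ S then a k else conj (a k)
  have ha : ∀ k, a k ^ 4 = -1 := by
    intro k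
    fin_cases k
    · change (ω ^ 3) ^ 4 = -1
      rw [← pow_mul, mul_comm, pow_mul, hω]
      norm_num
    · exact hω
    · change (ω ^ 7) ^ 4 = -1
      rw [← pow_mul, mul_comm, pow_mul, hω]
      norm_num
  have hd : ∀ k, d k ^ 4 = -1 := by
    intro k
    simp only [d]
    split_ifs
    · exact ha k
    · rw [← map_pow, ha, map_neg, map_one]
  have hpat : ∀ j k, (if k ∈ S then phase j k else conj (phase j k)) =
      phasePattern (d 0) (d 1) (d 2) j k := by
    intro j k
    have hdk : ![d 0, d 1, d 2] k = d k := by fin_cases k <;> rfl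
    rw [phase_eq_phasePattern, phasePattern_eq, phasePattern_eq, hdk]
    change (if k ∈ S then phaseSign j k * (if j < 4 then a k else conj (a k)) else
      conj (phaseSign j k * (if j < 4 then a k else conj (a k)))) = _
    simp only [d]
    split_ifs <;> simp [conj_phaseSign]
  have hconj : ∀ (j : Fin 8) (k : Fin 3), star (conjOn S k ![1, phase j k]) =
      ![1, phasePattern (d 0) (d 1) (d 2) j k] := by
    intro j k
    rw [← hpat]
    funext i
    unfold conjOn
    split_ifs <;> fin_cases i <;> simp
  have hstar : ∀ x y z : Fin 2 → ℂ, star (prodVec x y z) = prodVec (star x) (star y) (star z) := by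
    intro x y z
    funext i
    simp [prodVec]
  have hs : ∀ i, (√(weight p q r i) : ℂ) ≠ 0 := fun i => by
    exact_mod_cast (Real.sqrt_pos.2 (weight_pos hp hq hr i)).ne'
  have hg : (fun i => (√(weight p q r i) : ℂ) * v i) = 0 := by
    refine eq_zero_of_phasePattern (hd 0) (hd 1) (hd 2) fun j => ?_
    -- A rank-one matrix kills `v` iff the bra does; the row `000` shows it since that entry of the
    -- ket is nonzero.
    have hj := congrFun (h j) (0, 0, 0)
    rw [pureState, eta_eq_prodVec hp hq hr, partialTranspose_smul, partialTranspose_vecMulVec,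
      conjOn_rescale, conjOn_rescale, conjOn_rescale, ← eta_eq_prodVec hp hq hr,
      star_dotProduct_self] at hj
    have hn : ((∑ i, ‖eta p q r j i‖ ^ 2 : ℝ) : ℂ) ≠ 0 := by
      exact_mod_cast (sum_norm_sq_pos (eta_ne_zero hp hq hr j)).ne'
    simp only [Matrix.mulVec, dotProduct, Matrix.smul_apply, Matrix.vecMulVec_apply, Pi.star_apply,
      Pi.zero_apply, smul_eq_mul, mul_assoc] at hj
    rw [← Finset.mul_sum, ← Finset.mul_sum] at hj
    have hone : ∀ k x, conjOn S k ![1, x] 0 = 1 := by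
      intro k x
      unfold conjOn
      split_ifs <;> simp
    have h000 : prodVec (rescale p (conjOn S 0 ![1, phase j 0]))
        (rescale q (conjOn S 1 ![1, phase j 1])) (rescale r (conjOn S 2 ![1, phase j 2]))
        (0, 0, 0) ≠ 0 := by
      rw [prodVec_rescale hp hq]
      simpa [prodVec, hone] using hs (0, 0, 0)
    have hj' := (mul_eq_zero.1 ((mul_eq_zero.1 hj).resolve_left (inv_ne_zero hn))).resolve_left h000
    rw [← hj']
    refine Finset.sum_congr rfl fun i _ => ?_
    rw [← hconj, ← hconj, ← hconj, ← hstar, prodVec_rescale hp hq, star_mul', RCLike.star_def,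
      Complex.conj_ofReal, Pi.star_apply, RCLike.star_def]
    ring
  funext i
  exact (mul_eq_zero.1 (congrFun hg i)).resolve_left (hs i)

/-- The partial transposes of product states are positive semidefinite, so a kernel vector of a
positive combination is killed by every term, and the `eta` terms alone leave only zero. -/
theorem rank_partialTranspose {p q r : ℝ} (hp : 0 < p) (hq : 0 < q) (hr : 0 < r) (b : Idx)
    {c : Fin 10 → ℝ} (hc : ∀ i, 0 < c i) (S : Finset (Fin 3)) :
    (partialTranspose S (∑ i, c i • vertex p q r b i)).rank = 8 := by
  have hpsd : ∀ i, (partialTranspose S (vertex p q r b i)).PosSemidef := fun i =>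
    posSemidef_partialTranspose S ((mem_range_vertex_iff hp hq hr b _).1 ⟨i, rfl⟩).1
  rw [Matrix.rank_of_isUnit]
  · rfl
  rw [← Matrix.mulVec_injective_iff_isUnit, ← Matrix.coe_mulVecLin,
    ← LinearMap.ker_eq_bot, LinearMap.ker_eq_bot']
  intro v hv
  rw [Matrix.mulVecLin_apply, partialTranspose_sum] at hv
  have hsum :
      ∑ i, (c i : ℂ) * (star v ⬝ᵥ (partialTranspose S (vertex p q r b i)).mulVec v) = 0 := by
    have h := congrArg (fun w => star v ⬝ᵥ w) hv
    simp only [Matrix.sum_mulVec, dotProduct_sum, dotProduct_zero, Matrix.smul_mulVec,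
      dotProduct_smul, Complex.real_smul] at h
    exact h
  have hterm := (Finset.sum_eq_zero_iff_of_nonneg (fun i _ =>
    mul_nonneg (by exact_mod_cast (hc i).le) ((hpsd i).dotProduct_mulVec_nonneg v))).1 hsum
  have hker : ∀ i, (partialTranspose S (vertex p q r b i)).mulVec v = 0 := by
    intro i
    have h := (mul_eq_zero.1 (hterm i (Finset.mem_univ i))).resolve_left
      (by exact_mod_cast (hc i).ne')
    exact ((hpsd i).dotProduct_mulVec_zero_iff v).1 h
  refine eq_zero_of_partialTranspose_eta hp hq hr S fun j => ?_
  have h := hker (Fin.natAdd 2 j)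
  rwa [vertex, Fin.append_right] at h

/-! ### The witnesses and their dual faces -/

theorem isEntanglementWitness_xWitness {p q r : ℝ} (hp : 0 < p) (hq : 0 < q) (hr : 0 < r)
    (b : Idx) : IsEntanglementWitness (xWitness p q r b) := by
  refine ⟨isHermitian_xWitness p q r b, ?_, ?_⟩
  · intro ρ hρ
    exact convexHull_min (pairingRe_nonneg hp hq hr b)
      (convex_halfSpace_ge (pairingRe (xWitness p q r b)).isLinear 0) hρ
  -- The diagonal vanishes on the support of this vector, and the relative sign makes the
  -- anti-diagonal contribution negative.
  · let v : Idx → ℂ := Pi.single b 1 - Pi.single (opp b) (antiSign b : ℂ)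
    have hvb : v b = 1 := by simp [v, (opp_ne b).symm]
    have hvo : v (opp b) = -(antiSign b : ℂ) := by simp [v, opp_ne b]
    have hv0 : ∀ i, i ≠ b → i ≠ opp b → v i = 0 := fun i h h' => by simp [v, h, h']
    have hsq : antiSign b * antiSign b = 1 := by
      unfold antiSign
      split_ifs <;> norm_num
    have hne : v ≠ 0 := fun h => by simp [h] at hvb
    have hpos := sum_norm_sq_pos hne
    have hdot := star_dotProduct_self v
    have hform : witnessForm p q r b v = -6 := by
      have h1 : ∑ i, diagEntry p q r b i * ‖v i‖ ^ 2 = 0 := by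
        refine Finset.sum_eq_zero fun i _ => ?_
        by_cases h : i = b ∨ i = opp b
        · simp [diagEntry, h]
        · simp [hv0 i (fun hi => h (.inl hi)) (fun hi => h (.inr hi))]
      have h2 : ∑ i, antiSign i * (v i * conj (v (opp i))).re = -2 := by
        rw [Finset.sum_eq_add b (opp b) (opp_ne b).symm]
        · rw [opp_opp, hvb, hvo, antiSign_opp]
          simp
          linarith
        · intro i _ hi
          simp [hv0 i hi.1 hi.2]
        · simp
        · simp
      rw [witnessForm, h1, h2]
      norm_num
    refine ⟨pureState v, ⟨?_, ?_⟩, ?_⟩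
    · rw [pureState, hdot]
      refine (Matrix.posSemidef_vecMulVec_self_star v).smul ?_
      rw [← Complex.ofReal_inv]
      exact_mod_cast (inv_pos.2 hpos).le
    · rw [pureState, Matrix.trace_smul, Matrix.trace_vecMulVec, dotProduct_comm v, smul_eq_mul,
        hdot]
      exact inv_mul_cancel₀ (by exact_mod_cast hpos.ne')
    · rw [pairing_pureState, hform, hdot, ← Complex.ofReal_inv, ← Complex.ofReal_mul,
        Complex.ofReal_re]
      have := inv_pos.2 hpos
      linarith

theorem pairingRe_single_pos {p q r : ℝ} (hp : 0 < p) (hq : 0 < q) (hr : 0 < r) {b k : Idx}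
    (hk : k ≠ b) (hk' : k ≠ opp b) :
    0 < pairingRe (xWitness p q r b) (pureState (Pi.single k 1)) := by
  have hunit : star (Pi.single k 1 : Idx → ℂ) ⬝ᵥ Pi.single k 1 = 1 := by simp
  have hform : witnessForm p q r b (Pi.single k 1) = √8 * (weight p q r k)⁻¹ := by
    rw [witnessForm, Finset.sum_eq_single k, Finset.sum_eq_zero]
    · simp [diagEntry, hk, hk']
    · intro i _
      by_cases hi : i = k
      · subst hi
        simp [opp_ne]
      · simp [hi]
    · intro i _ hi
      simp [hi]
    · simp
  change 0 < (pairing _ _).re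
  rw [pairing_pureState, hunit, hform, inv_one, one_mul, Complex.ofReal_re]
  have := weight_pos hp hq hr k
  positivity

theorem mem_intrinsicFrontier_separableStates {p q r : ℝ} (hp : 0 < p) (hq : 0 < q) (hr : 0 < r)
    {b : Idx} {ρ : Mat} (hρ : ρ ∈ dualFace (xWitness p q r b)) :
    ρ ∈ intrinsicFrontier ℝ separableStates := by
  have hcl : ρ ∈ intrinsicClosure ℝ separableStates := subset_intrinsicClosure hρ.1
  rw [← intrinsicInterior_union_intrinsicFrontier] at hcl
  refine hcl.resolve_left fun hρ_mem => ?_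
  obtain ⟨k, hk, hk'⟩ := exists_ne_and_ne_opp b
  have hpos := pos_of_mem_intrinsicInterior (f := pairingRe (xWitness p q r b))
    (isEntanglementWitness_xWitness hp hq hr b).2.1
    (subset_convexHull ℝ _ (pureState_single_mem k)) (pairingRe_single_pos hp hq hr hk hk') hρ_mem
  exact hpos.ne' ((pairing_eq_zero_iff hρ.1).1 hρ.2)

/-- Every state of positive weight in a decomposition is itself a zero of the witness, hence a
vertex; linear independence then fixes the weights. -/
theorem existsUnique_isDecomposition {p q r : ℝ} (hp : 0 < p) (hq : 0 < q) (hr : 0 < r)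
    {b : Idx} {ρ : Mat} (hρ : ρ ∈ dualFace (xWitness p q r b)) :
    ∃! w : Mat →₀ ℝ, IsDecomposition ρ w := by
  have hv := linearIndependent_vertex hp hq hr b
  have hsupp : ∀ w, IsDecomposition ρ w → (w.support : Set Mat) ⊆ Set.range (vertex p q r b) := by
    rintro w ⟨hw, hw0, -, hws⟩ P hP
    refine (mem_range_vertex_iff hp hq hr b P).2 ⟨hw hP, ?_⟩
    refine eq_zero_of_sum_eq_zero (T := w.support) (c := w) (z := id)
      (pairingRe_nonneg hp hq hr b) (fun i _ => hw0 i) (fun i hi => hw hi) ?_ hP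
      (Finsupp.mem_support_iff.1 hP)
    have : ∑ i ∈ w.support, w i • id i = ρ := hws
    rw [this]
    exact (pairing_eq_zero_iff hρ.1).1 hρ.2
  obtain ⟨w, hw, hw0, hw1, hws⟩ := exists_finsupp_decomposition hv
    (dualFace_xWitness hp hq hr b ▸ hρ)
  refine ⟨w, ⟨fun P hP => ((mem_range_vertex_iff hp hq hr b P).1 (hw hP)).1, hw0, hw1, hws⟩, ?_⟩
  intro w' hw'
  exact finsupp_decomposition_unique hv (hsupp w' hw') hw (hw'.2.2.2.trans hws.symm)

theorem sepLength_eq_ten {p q r : ℝ} (hp : 0 < p) (hq : 0 < q) (hr : 0 < r) {b : Idx}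
    {c : Fin 10 → ℝ} (hc : ∀ i, 0 < c i) (hc1 : ∑ i, c i = 1) :
    sepLength (∑ i, c i • vertex p q r b i) = 10 := by
  have hv := fun i => (mem_range_vertex_iff hp hq hr b (vertex p q r b i)).1 ⟨i, rfl⟩
  refine le_antisymm (Nat.sInf_le ⟨_, c, fun i => (hv i).1, fun i => (hc i).le, hc1, rfl⟩) ?_
  -- The given decomposition shows that the set of lengths is nonempty; an empty set would have
  -- infimum 0.
  refine le_csInf ⟨10, _, c, fun i => (hv i).1, fun i => (hc i).le, hc1, rfl⟩ ?_
  rintro m ⟨P, d, hP, hd, -, hsum⟩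
  refine card_le_of_sum_eq (linearIndependent_vertex hp hq hr b) hc (fun k hk => ?_) hsum
  refine (mem_range_vertex_iff hp hq hr b _).2 ⟨hP k, ?_⟩
  refine eq_zero_of_sum_eq_zero (T := Finset.univ) (pairingRe_nonneg hp hq hr b)
    (fun i _ => hd i) (fun i _ => hP i) ?_ (Finset.mem_univ k) hk
  rw [hsum, map_sum]
  exact Finset.sum_eq_zero fun i _ => by rw [map_smul, (hv i).2, smul_zero]

theorem xWitness_dualFace_properties {p q r : ℝ} (hp : 0 < p) (hq : 0 < q) (hr : 0 < r)
    (b : Idx) :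
    IsEntanglementWitness (xWitness p q r b) ∧
    (AffinelyIsomorphic (stdSimplex ℝ (Fin 10)) (dualFace (xWitness p q r b)) ∧
      (dualFace (xWitness p q r b)).extremePoints ℝ =
        {pureState (Pi.single b 1), pureState (Pi.single (opp b) 1)} ∪
          Set.range (fun j : Fin 8 => pureState (eta p q r j)) ∧
      ((dualFace (xWitness p q r b)).extremePoints ℝ).ncard = 10) ∧
    (∀ ρ ∈ dualFace (xWitness p q r b),
      ρ ∈ separableStates ∧ ∃! w : Mat →₀ ℝ, IsDecomposition ρ w) ∧
    (∀ ρ ∈ intrinsicInterior ℝ (dualFace (xWitness p q r b)),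
      IsBoundarySeparableFullRanks ρ ∧ sepLength ρ = 10) := by
  have hv := linearIndependent_vertex hp hq hr b
  have hface := dualFace_xWitness hp hq hr b
  have hext : (dualFace (xWitness p q r b)).extremePoints ℝ = Set.range (vertex p q r b) := by
    rw [hface, extremePoints_convexHull_range hv]
  refine ⟨isEntanglementWitness_xWitness hp hq hr b, ⟨?_, ?_, ?_⟩, ?_, ?_⟩
  · rw [hface]
    exact affinelyIsomorphic_convexHull_range hv
  · rw [hext, range_vertex]
  · rw [hext, ← Set.image_univ, Set.ncard_image_of_injective _ hv.injective, Set.ncard_univ,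
      Nat.card_fin]
  · exact fun ρ hρ => ⟨hρ.1, existsUnique_isDecomposition hp hq hr hρ⟩
  · intro ρ hρ
    have hmem := intrinsicInterior_subset hρ
    rw [hface] at hρ
    obtain ⟨c, hc, hc1, rfl⟩ := exists_pos_of_mem_intrinsicInterior hv hρ
    exact ⟨⟨hmem.1, mem_intrinsicFrontier_separableStates hp hq hr hmem,
      rank_partialTranspose hp hq hr b hc⟩, sepLength_eq_ten hp hq hr hc hc1⟩

end ThreeQubit

/-! ### The four witnesses as instances of the common form -/

theorem theorem3p1 (u : ℝ) (hu : 0 < u) (V : Mat) (b₁ b₂ : Idx) (p q r : ℝ)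
    (hV : (V, b₁, b₂, p, q, r) ∈
      ({(W u + WA u + WB u, (0, 1, 0), (1, 0, 1), 1, 1, u⁻¹),
        (W u + WB u + WC u, (0, 0, 0), (1, 1, 1), u, 1, 1),
        (W u + WC u + WA u, (0, 0, 1), (1, 1, 0), 1, u⁻¹, 1),
        (WA u + WB u + WC u, (0, 1, 1), (1, 0, 0), u, u⁻¹, u⁻¹)} :
        Set (Mat × Idx × Idx × ℝ × ℝ × ℝ))) :
    IsEntanglementWitness V ∧
    -- (i)
    (AffinelyIsomorphic (stdSimplex ℝ (Fin 10)) (dualFace V) ∧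
      (dualFace V).extremePoints ℝ =
        {pureState (Pi.single b₁ 1), pureState (Pi.single b₂ 1)} ∪
          Set.range (fun j : Fin 8 => pureState (eta p q r j)) ∧
      ((dualFace V).extremePoints ℝ).ncard = 10) ∧
    -- (ii)
    (∀ ρ ∈ dualFace V, ρ ∈ separableStates ∧ ∃! w : Mat →₀ ℝ, IsDecomposition ρ w) ∧
    -- (iii)
    (∀ ρ ∈ intrinsicInterior ℝ (dualFace V),
      IsBoundarySeparableFullRanks ρ ∧ sepLength ρ = 10) := by
  have hu' : 0 < u⁻¹ := inv_pos.2 hu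
  simp only [Set.mem_insert_iff, Set.mem_singleton_iff, Prod.mk.injEq] at hV
  rcases hV with ⟨rfl, rfl, rfl, rfl, rfl, rfl⟩ | ⟨rfl, rfl, rfl, rfl, rfl, rfl⟩ |
    ⟨rfl, rfl, rfl, rfl, rfl, rfl⟩ | ⟨rfl, rfl, rfl, rfl, rfl, rfl⟩
  · rw [W_add_WA_add_WB]
    exact xWitness_dualFace_properties one_pos one_pos hu' (0, 1, 0)
  · rw [W_add_WB_add_WC]
    exact xWitness_dualFace_properties hu one_pos one_pos (0, 0, 0)
  · rw [W_add_WC_add_WA]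
    exact xWitness_dualFace_properties one_pos hu' one_pos (0, 0, 1)
  · rw [WA_add_WB_add_WC hu]
    exact xWitness_dualFace_properties hu hu' hu' (0, 1, 1)
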